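/- Let $n\neq 1$, let $r>0$, let $U\subseteq\mathbb{R}^n$ be open (with $\mathbb{R}^n$ carrying the Euclidean norm), and let $g_1\colon U\to\mathbb{R}$ be continuous. Assume that $g_1$ is a $C^{1,1}$-submersion on its zero set, i.e., for every $x\in U$ with $g_1(x)=0$, the function $g_1$ is continuously differentiable with Lipschitz continuous derivative on a neighborhood of $x$, and $g_1'(x)\colon\mathbb{R}^n\to\mathbb{R}$ is surjective. Assume further that the set $$\Omega=\{x\in U \mid g_1(x)\le 0\}$$ is closed in $\mathbb{R}^n$ and connected (the empty set counts as connected). Call $\Omega$ $r$-convex if for all $x,y\in\Omega$ the intersection of all closed balls of radius $r$ that contain both $x$ and $y$ is a subset of $\Omega$; this intersection is understood to be $\mathbb{R}^n$ if no such ball exists. Then $\Omega$ is $r$-convex if and only if $$\liminf_{t\to 0,\,t>0}\frac{g_1'(x+th)h}{t}\ \ge\ \frac{1}{r}\,\|g_1'(x)\|\cdot\|h\|^2$$ for all $x\in\partial\Omega$ and all $h\in\ker g_1'(x)$. -/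

import Mathlib

open scoped Topology NNReal

/-- The lens spanned by `x` and `y`: the intersection of all closed balls of radius `r` which
contain both `x` and `y` (the whole space if there is no such ball). -/
def lens {n : ℕ} (r : ℝ) (x y : EuclideanSpace ℝ (Fin n)) : Set (EuclideanSpace ℝ (Fin n)) :=
  {z | ∀ c : EuclideanSpace ℝ (Fin n),
    x ∈ Metric.closedBall c r → y ∈ Metric.closedBall c r → z ∈ Metric.closedBall c r}

/-- `Ω` is `r`-convex if it contains the lens spanned by any two of its points. -/
def IsRConvex {n : ℕ} (r : ℝ) (Ω : Set (EuclideanSpace ℝ (Fin n))) : Prop :=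
  ∀ x ∈ Ω, ∀ y ∈ Ω, lens r x y ⊆ Ω

/-- `f` is of class `C^{1,1}` on the open set `V`: continuously differentiable with Lipschitz
continuous derivative. -/
def IsC11On {n : ℕ} (f : EuclideanSpace ℝ (Fin n) → ℝ) (V : Set (EuclideanSpace ℝ (Fin n))) :
    Prop :=
  ContDiffOn ℝ 1 f V ∧ ∃ K : ℝ≥0, LipschitzOnWith K (fderiv ℝ f) V

/-- `g`, considered as a function with domain the open set `U`, is a `C^{1,1}`-submersion on its
zero set: near every zero `g` is of class `C^{1,1}`, and its derivative there is surjective. -/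
def IsC11SubmersionOnZeroSet {n : ℕ} (U : Set (EuclideanSpace ℝ (Fin n)))
    (g : EuclideanSpace ℝ (Fin n) → ℝ) : Prop :=
  ∀ x ∈ U, g x = 0 →
    (∃ V : Set (EuclideanSpace ℝ (Fin n)), IsOpen V ∧ x ∈ V ∧ V ⊆ U ∧ IsC11On g V) ∧
      Function.Surjective (fderiv ℝ g x)

/-- The sublevel set `{x ∈ U | g x ≤ 0}`. -/
def sublevelSet {n : ℕ} (U : Set (EuclideanSpace ℝ (Fin n)))
    (g : EuclideanSpace ℝ (Fin n) → ℝ) : Set (EuclideanSpace ℝ (Fin n)) :=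
  {x | x ∈ U ∧ g x ≤ 0}

open Filter Set

/-! Both sides of the equivalence say that `Ω` lies, for each boundary point `p`, in the ball of
radius `r` tangent to the boundary at `p`. With centre `p - r N / ‖N‖`, `N` the gradient, this reads
`‖N‖ * ‖q - p‖ ^ 2 + 2 * r * g'(p)(q - p) ≤ 0` for all `q ∈ Ω`.

Tangent balls and `r`-convexity. If `z ∉ Ω` were in the lens of `x, y ∈ Ω`, the tangent ball at the
last point `p` of `Ω` on the segment from `x` to `z` would contain `z`, yet it meets the outer
half-space at `p` only in `p` (`isRConvex`). Conversely, if `q` is outside the tangent ball at `p`,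
the lens of `p` and `q` leaves `Ω` at `p` (`supporting_ball_of_isRConvex`).

Tangent balls give the second order condition by adding the inequalities for two nearby boundary
points in both orders (`hasCurvatureBound`).

The hard direction is Blaschke's rolling theorem (`supporting_ball`). Under the second order
condition no curve of curvature less than `1 / r` touches the boundary from inside, so families of
such curves can be swept through the interior. Sweeping segments shows that the interior is convex;
bending a chord into arcs of radius greater than `r` keeps it in `Ω`. If some `q ∈ Ω` lay outside
the tangent ball at `p`, such an arc from `p` to `q` would leave `Ω` at `p`. -/

/-- `g` is differentiable on the ball of radius `δ` around `p`, with `K`-Lipschitz derivative. -/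
structure IsC11OnBall {E : Type*} [NormedAddCommGroup E] [NormedSpace ℝ E]
    (g : E → ℝ) (p : E) (δ K : ℝ) : Prop where
  pos : 0 < δ
  nonneg : 0 ≤ K
  hasFDerivAt : ∀ z ∈ Metric.ball p δ, HasFDerivAt g (fderiv ℝ g z) z
  lipschitz : ∀ z ∈ Metric.ball p δ, ∀ z' ∈ Metric.ball p δ,
    ‖fderiv ℝ g z - fderiv ℝ g z'‖ ≤ K * ‖z - z'‖

/-- `Ω` is closed and, near each of its boundary points, the sublevel set of the
`C^{1,1}`-submersion `g`. -/
structure IsC11Domain {E : Type*} [NormedAddCommGroup E] [NormedSpace ℝ E]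
    (Ω : Set E) (g : E → ℝ) : Prop where
  isClosed : IsClosed Ω
  eq_zero : ∀ p ∈ frontier Ω, g p = 0
  fderiv_ne_zero : ∀ p ∈ frontier Ω, fderiv ℝ g p ≠ 0
  exists_ball : ∀ p ∈ frontier Ω, ∃ δ K : ℝ, IsC11OnBall g p δ K ∧
    ∀ z ∈ Metric.ball p δ, (z ∈ Ω ↔ g z ≤ 0) ∧ (g z = 0 → z ∈ frontier Ω)

/-- The second order condition on the boundary. -/
def HasCurvatureBound {E : Type*} [NormedAddCommGroup E] [NormedSpace ℝ E]
    (r : ℝ) (Ω : Set E) (g : E → ℝ) : Prop :=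
  ∀ x ∈ frontier Ω, ∀ h : E, fderiv ℝ g x h = 0 →
    (((1 / r) * ‖fderiv ℝ g x‖ * ‖h‖ ^ 2 : ℝ) : EReal) ≤
      liminf (fun t : ℝ => ((fderiv ℝ g (x + t • h) h / t : ℝ) : EReal)) (𝓝[>] 0)

/-! ### Local behaviour at the boundary and the touching principle -/

section Local

variable {E : Type*} [NormedAddCommGroup E] [NormedSpace ℝ E] {g : E → ℝ} {p : E} {δ K : ℝ}
  {Ω : Set E} {r : ℝ}

theorem IsC11OnBall.mem_ball (hg : IsC11OnBall g p δ K) : p ∈ Metric.ball p δ :=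
  Metric.mem_ball_self hg.pos

theorem IsC11OnBall.continuousAt_fderiv (hg : IsC11OnBall g p δ K) :
    ContinuousAt (fderiv ℝ g) p := by
  rw [ContinuousAt, tendsto_iff_norm_sub_tendsto_zero]
  have h : Tendsto (fun z => K * ‖z - p‖) (𝓝 p) (𝓝 0) := by
    have : ContinuousAt (fun z => K * ‖z - p‖) p := by fun_prop
    simpa [ContinuousAt] using this
  refine squeeze_zero' (Eventually.of_forall fun _ => norm_nonneg _) ?_ h
  filter_upwards [Metric.ball_mem_nhds p hg.pos] with z hz
  exact hg.lipschitz z hz p hg.mem_ball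

theorem IsC11OnBall.hasStrictFDerivAt (hg : IsC11OnBall g p δ K) :
    HasStrictFDerivAt g (fderiv ℝ g p) p := by
  refine hasStrictFDerivAt_of_hasFDerivAt_of_continuousAt ?_ hg.continuousAt_fderiv
  filter_upwards [Metric.ball_mem_nhds p hg.pos] with z hz using hg.hasFDerivAt z hz

/-- First order Taylor expansion with quadratic remainder. -/
theorem IsC11OnBall.taylor (hg : IsC11OnBall g p δ K) {w : E} (hw : ‖w‖ < δ) :
    |g (p + w) - g p - fderiv ℝ g p w| ≤ K * ‖w‖ ^ 2 := by
  have hsub : Metric.closedBall p ‖w‖ ⊆ Metric.ball p δ := Metric.closedBall_subset_ball hw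
  have := (convex_closedBall p ‖w‖).norm_image_sub_le_of_norm_hasFDerivWithin_le'
    (f := g) (f' := fderiv ℝ g) (φ := fderiv ℝ g p) (C := K * ‖w‖) (x := p) (y := p + w)
    (fun z hz => (hg.hasFDerivAt z (hsub hz)).hasFDerivWithinAt)
    (fun z hz => (hg.lipschitz z (hsub hz) p hg.mem_ball).trans
      (mul_le_mul_of_nonneg_left (mem_closedBall_iff_norm.1 hz) hg.nonneg))
    (Metric.mem_closedBall_self (norm_nonneg _)) (by simp)
  rw [add_sub_cancel_left, Real.norm_eq_abs] at this
  nlinarith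

theorem IsC11Domain.mem_of_mem_frontier (hΩ : IsC11Domain Ω g) (hp : p ∈ frontier Ω) : p ∈ Ω :=
  hΩ.isClosed.frontier_subset hp

/-- A curve which starts at a boundary point in an outward direction leaves `Ω`. -/
theorem IsC11Domain.eventually_notMem (hΩ : IsC11Domain Ω g) {γ : ℝ → E} {w : E}
    (hp : γ 0 ∈ frontier Ω) (hγ : HasDerivAt γ w 0) (hw : 0 < fderiv ℝ g (γ 0) w) :
    ∀ᶠ t in 𝓝[>] (0 : ℝ), γ t ∉ Ω := by
  obtain ⟨δ, K, hg, hball⟩ := hΩ.exists_ball _ hp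
  have hd : HasDerivAt (fun t => g (γ t)) (fderiv ℝ g (γ 0) w) 0 :=
    (hg.hasFDerivAt _ hg.mem_ball).comp_hasDerivAt 0 hγ
  have h1 := hd.tendsto_slope_zero_right
  have h2 : ∀ᶠ t in 𝓝[>] (0 : ℝ), γ t ∈ Metric.ball (γ 0) δ :=
    (hγ.continuousAt.eventually (Metric.ball_mem_nhds _ hg.pos)).filter_mono nhdsWithin_le_nhds
  filter_upwards [h1.eventually (lt_mem_nhds hw), h2, self_mem_nhdsWithin] with t ht ht2 ht0
  rw [(hball _ ht2).1, not_le]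
  simp only [zero_add, hΩ.eq_zero _ hp, sub_zero, smul_eq_mul] at ht
  exact pos_of_mul_pos_right ht (inv_nonneg.2 (le_of_lt ht0))

/-- A curve whose curvature is less than `1 / r` cannot touch the boundary from inside. -/
theorem IsC11Domain.false_of_touching (hΩ : IsC11Domain Ω g) (hr : 0 < r)
    (hc : HasCurvatureBound r Ω g) {γ γ' : ℝ → E} {w : E}
    (hγ : ∀ s, HasDerivAt γ (γ' s) s) (hγ' : HasDerivAt γ' w 0) (hw : r * ‖w‖ < ‖γ' 0‖ ^ 2)
    (hp : γ 0 ∈ frontier Ω) (hin : ∀ᶠ s in 𝓝 0, γ s ∈ Ω) : False := by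
  obtain ⟨δ, K, hg, hball⟩ := hΩ.exists_ball _ hp
  set p := γ 0 with hpdef
  set T := γ' 0 with hTdef
  have hN : 0 < ‖fderiv ℝ g p‖ := norm_pos_iff.2 (hΩ.fderiv_ne_zero p hp)
  have hev : ∀ᶠ s in 𝓝 (0 : ℝ), γ s ∈ Metric.ball p δ :=
    (hγ 0).continuousAt.eventually (Metric.ball_mem_nhds _ hg.pos)
  have hd : ∀ᶠ s in 𝓝 (0 : ℝ), HasDerivAt (fun t => g (γ t)) (fderiv ℝ g (γ s) (γ' s)) s := by
    filter_upwards [hev] with s hs using (hg.hasFDerivAt _ hs).comp_hasDerivAt s (hγ s)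
  have hle : ∀ᶠ s in 𝓝 (0 : ℝ), g (γ s) ≤ 0 := by
    filter_upwards [hev, hin] with s hs hs' using (hball _ hs).1.1 hs'
  have h0 : g (γ 0) = 0 := hΩ.eq_zero _ hp
  have hT : fderiv ℝ g p T = 0 := by
    refine IsLocalMax.hasDerivAt_eq_zero (f := fun t => g (γ t)) (a := 0) ?_ hd.self_of_nhds
    filter_upwards [hle] with s hs
    rwa [h0]
  -- the three parts of the derivative along the curve
  obtain ⟨c, hc1, hc2⟩ : ∃ c, ‖fderiv ℝ g p‖ * ‖w‖ < c ∧ c < 1 / r * ‖fderiv ℝ g p‖ * ‖T‖ ^ 2 := by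
    refine exists_between ?_
    rw [div_mul_eq_mul_div, one_mul, div_mul_eq_mul_div, lt_div_iff₀ hr]
    nlinarith
  have e1 : ∀ᶠ t in 𝓝[>] (0 : ℝ), c < fderiv ℝ g (p + t • T) T / t := by
    have := eventually_lt_of_lt_liminf ((EReal.coe_lt_coe_iff.2 hc2).trans_le (hc p hp T hT))
    simpa only [EReal.coe_lt_coe_iff] using this
  have hs1 : Tendsto (fun t : ℝ => t⁻¹ • (γ t - p)) (𝓝[>] 0) (𝓝 T) := by
    simpa only [zero_add] using (hγ 0).tendsto_slope_zero_right
  have hs2 : Tendsto (fun t : ℝ => t⁻¹ • (γ' t - T)) (𝓝[>] 0) (𝓝 w) := by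
    simpa only [zero_add] using hγ'.tendsto_slope_zero_right
  have e2 : Tendsto (fun t : ℝ => K * ‖t⁻¹ • (γ t - p) - T‖ * ‖T‖) (𝓝[>] 0) (𝓝 0) := by
    simpa using ((hs1.sub_const T).norm.const_mul K).mul_const ‖T‖
  have hgc : Tendsto (fun t : ℝ => fderiv ℝ g (γ t)) (𝓝[>] 0) (𝓝 (fderiv ℝ g p)) :=
    (hg.continuousAt_fderiv.tendsto.comp (hγ 0).continuousAt.tendsto).mono_left nhdsWithin_le_nhds
  have e3 : Tendsto (fun t : ℝ => ‖fderiv ℝ g (γ t)‖ * ‖t⁻¹ • (γ' t - T)‖) (𝓝[>] 0)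
      (𝓝 (‖fderiv ℝ g p‖ * ‖w‖)) := hgc.norm.mul hs2.norm
  have e4 : ∀ᶠ t in 𝓝[>] (0 : ℝ), K * ‖t⁻¹ • (γ t - p) - T‖ * ‖T‖ +
      ‖fderiv ℝ g (γ t)‖ * ‖t⁻¹ • (γ' t - T)‖ < c :=
    (e2.add e3).eventually (gt_mem_nhds (by simpa using hc1))
  have e5 : ∀ᶠ t in 𝓝[>] (0 : ℝ), p + t • T ∈ Metric.ball p δ := by
    have : ContinuousAt (fun t : ℝ => p + t • T) 0 := by fun_prop
    refine (this.eventually (Metric.ball_mem_nhds _ hg.pos)).filter_mono nhdsWithin_le_nhds |>.mono ?_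
    simp
  have hpos : ∀ᶠ t in 𝓝[>] (0 : ℝ), 0 < fderiv ℝ g (γ t) (γ' t) := by
    filter_upwards [e1, e4, e5, hev.filter_mono nhdsWithin_le_nhds, self_mem_nhdsWithin]
      with t h1 h4 h5 h6 ht
    have ht : 0 < t := ht
    -- The first term exceeds `c` by the curvature bound, the second tends to zero by the Lipschitz
    -- condition, and the third is asymptotically at most `‖g'(p)‖ * ‖w‖ < c`.
    have key : fderiv ℝ g (γ t) (γ' t) / t = fderiv ℝ g (p + t • T) T / t
        + ((fderiv ℝ g (γ t) - fderiv ℝ g (p + t • T)) T) / t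
        + fderiv ℝ g (γ t) (t⁻¹ • (γ' t - T)) := by
      simp only [sub_apply, map_smul, map_sub, smul_eq_mul]
      field_simp
      ring
    have b1 : |(fderiv ℝ g (γ t) - fderiv ℝ g (p + t • T)) T / t| ≤
        K * ‖t⁻¹ • (γ t - p) - T‖ * ‖T‖ := by
      rw [abs_div, abs_of_pos ht, div_le_iff₀ ht]
      have a1 := (fderiv ℝ g (γ t) - fderiv ℝ g (p + t • T)).le_opNorm T
      have a2 := hg.lipschitz _ h6 _ h5
      have a3 : ‖γ t - (p + t • T)‖ = t * ‖t⁻¹ • (γ t - p) - T‖ := by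
        rw [← abs_of_pos ht, ← Real.norm_eq_abs, ← norm_smul, smul_sub, Real.norm_eq_abs,
          abs_of_pos ht, smul_smul, mul_inv_cancel₀ ht.ne', one_smul]
        congr 1; abel
      rw [a3] at a2
      rw [Real.norm_eq_abs] at a1
      nlinarith [norm_nonneg T]
    have b2 : |fderiv ℝ g (γ t) (t⁻¹ • (γ' t - T))| ≤
        ‖fderiv ℝ g (γ t)‖ * ‖t⁻¹ • (γ' t - T)‖ := (fderiv ℝ g (γ t)).le_opNorm _
    have : 0 < fderiv ℝ g (γ t) (γ' t) / t := by
      rw [key]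
      linarith [neg_abs_le ((fderiv ℝ g (γ t) - fderiv ℝ g (p + t • T)) T / t),
        neg_abs_le (fderiv ℝ g (γ t) (t⁻¹ • (γ' t - T)))]
    exact (div_pos_iff_of_pos_right ht).1 this
  -- By the mean value theorem `g ∘ γ` becomes positive, so the curve leaves `Ω`.
  obtain ⟨ε, hε, hall⟩ := mem_nhdsGT_iff_exists_Ioc_subset.1
    (hpos.and ((hd.and hle).filter_mono nhdsWithin_le_nhds))
  have hε : (0 : ℝ) < ε := hε
  obtain ⟨s, hs, hs'⟩ := exists_hasDerivAt_eq_slope (fun t => g (γ t))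
    (fun s => fderiv ℝ g (γ s) (γ' s)) hε
    (fun t ht => by
      rcases eq_or_lt_of_le ht.1 with h | h
      · rw [← h]; exact hd.self_of_nhds.continuousAt.continuousWithinAt
      · exact (hall ⟨h, ht.2⟩).2.1.continuousAt.continuousWithinAt)
    (fun t ht => (hall ⟨ht.1, ht.2.le⟩).2.1)
  have h3 := (hall ⟨hs.1, hs.2.le⟩).1
  have h4 := (hall ⟨hε, le_rfl⟩).2.2
  rw [hs', h0, sub_zero, sub_zero] at h3
  exact absurd ((div_pos_iff_of_pos_right hε).1 h3) (not_lt.2 h4)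

end Local

/-! ### Sweeping compact families through the interior -/

/-- No curve of curvature less than `1 / r` touches the boundary of `Ω` from inside. -/
def ResistsTouching {E : Type*} [NormedAddCommGroup E] [NormedSpace ℝ E]
    (r : ℝ) (Ω : Set E) : Prop :=
  ∀ (γ γ' : ℝ → E) (w : E), (∀ s, HasDerivAt γ (γ' s) s) → HasDerivAt γ' w 0 →
    r * ‖w‖ < ‖γ' 0‖ ^ 2 → (∀ᶠ s in 𝓝 0, γ s ∈ Ω) → γ 0 ∈ interior Ω

theorem IsC11Domain.resistsTouching {E : Type*} [NormedAddCommGroup E] [NormedSpace ℝ E]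
    {g : E → ℝ} {Ω : Set E} {r : ℝ} (hΩ : IsC11Domain Ω g) (hr : 0 < r)
    (hc : HasCurvatureBound r Ω g) : ResistsTouching r Ω := by
  intro γ γ' w hγ hγ' hw hin
  by_contra hp
  exact hΩ.false_of_touching hr hc hγ hγ' hw
    (hΩ.isClosed.frontier_eq ▸ ⟨hin.self_of_nhds, hp⟩) hin

/-- A continuous family of compact sets which starts in the interior of a closed set `Ω` and never
touches the boundary of `Ω` from inside remains in the interior. -/
theorem sweep_subset_interior {X κ : Type*} [TopologicalSpace X] [TopologicalSpace κ]
    {Ω : Set X} (hΩ : IsClosed Ω) {F : ℝ → κ → X} (hF : Continuous (Function.uncurry F))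
    {k : Set κ} (hk : IsCompact k) {a b : ℝ} (hab : a ≤ b) (h0 : ∀ s ∈ k, F a s ∈ interior Ω)
    (hstep : ∀ τ ∈ Ioc a b, (∀ s ∈ k, F τ s ∈ Ω) → ∀ s ∈ k, F τ s ∈ interior Ω) :
    ∀ s ∈ k, F b s ∈ interior Ω := by
  -- By `hstep`, the good parameters are also those whose whole set lies in `Ω`, a closed condition;
  -- compactness of `k` makes them open.
  have hS : {τ | ∀ s ∈ k, F τ s ∈ interior Ω} ∩ Icc a b =
      (⋂ s ∈ k, {τ | F τ s ∈ Ω}) ∩ Icc a b := by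
    ext τ
    simp only [mem_inter_iff, mem_ofPred_eq, mem_iInter, and_congr_left_iff]
    intro hτ
    refine ⟨fun h s hs => interior_subset (h s hs), fun h => ?_⟩
    rcases eq_or_lt_of_le hτ.1 with e | e
    · rwa [← e]
    · exact hstep τ ⟨e, hτ.2⟩ h
  have hcl : IsClosed ({τ | ∀ s ∈ k, F τ s ∈ interior Ω} ∩ Icc a b) := by
    rw [hS]
    refine (isClosed_biInter fun s _ => hΩ.preimage ?_).inter isClosed_Icc
    exact hF.comp (Continuous.prodMk_left s)
  refine hcl.Icc_subset_of_forall_mem_nhdsWithin h0 (fun τ hτ => ?_) (right_mem_Icc.2 hab)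
  refine mem_nhdsWithin_of_mem_nhds ?_
  refine hk.eventually_forall_of_forall_eventually (P := fun τ s => F τ s ∈ interior Ω) ?_
  intro s hs
  exact hF.continuousAt.eventually (isOpen_interior.mem_nhds (hτ.1 s hs))

/-! ### Convexity of the interior -/

section Segments

variable {E : Type*} [NormedAddCommGroup E] [NormedSpace ℝ E] {Ω : Set E} {r : ℝ}

theorem ResistsTouching.segment_subset_interior (hT : ResistsTouching r Ω) {a b : E}
    (ha : a ∈ interior Ω) (hb : b ∈ interior Ω) (h : segment ℝ a b ⊆ Ω) :
    segment ℝ a b ⊆ interior Ω := by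
  rcases eq_or_ne a b with rfl | hab
  · simpa using ha
  rw [segment_eq_image'] at h ⊢
  rintro _ ⟨s, hs, rfl⟩
  rcases eq_or_lt_of_le hs.1 with rfl | h0
  · simpa using ha
  rcases eq_or_lt_of_le hs.2 with rfl | h1
  · simpa using hb
  have key := hT (fun t => a + (s + t) • (b - a)) (fun _ => b - a) 0
    (fun t => by
      simpa using (((hasDerivAt_id t).const_add s).smul_const (b - a)).const_add a)
    (hasDerivAt_const _ _)
    (by
      rw [norm_zero, mul_zero]
      exact pow_pos (norm_pos_iff.2 (sub_ne_zero.2 hab.symm)) 2) ?_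
  · simpa using key
  · have : ContinuousAt (fun t : ℝ => s + t) 0 := by fun_prop
    filter_upwards [this.eventually (Icc_mem_nhds (by simpa using h0) (by simpa using h1))]
      with t ht
    exact h ⟨s + t, ht, rfl⟩

/-- The far end of the segment slides from `b` to `c`; segments have curvature zero, so they never
touch the boundary on the way. -/
theorem ResistsTouching.segment_trans (hT : ResistsTouching r Ω) (hΩ : IsClosed Ω) {a b c : E}
    (hab : segment ℝ a b ⊆ interior Ω) (hbc : segment ℝ b c ⊆ interior Ω) :
    segment ℝ a c ⊆ interior Ω := by
  have key := sweep_subset_interior hΩ (a := 0) (b := 1) (k := Icc (0 : ℝ) 1)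
    (F := fun τ s => a + s • ((b + τ • (c - b)) - a)) (by fun_prop) isCompact_Icc zero_le_one
    (fun s hs => hab (by rw [segment_eq_image']; exact ⟨s, hs, by simp⟩))
    (fun τ hτ hin s hs => by
      have hb' : b + τ • (c - b) ∈ interior Ω :=
        hbc (by rw [segment_eq_image']; exact ⟨τ, ⟨hτ.1.le, hτ.2⟩, rfl⟩)
      refine hT.segment_subset_interior (hab (left_mem_segment ℝ a b)) hb' ?_ ?_
      · rw [segment_eq_image']
        rintro _ ⟨s, hs, rfl⟩
        exact hin s hs
      · rw [segment_eq_image']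
        exact ⟨s, hs, rfl⟩)
  rw [segment_eq_image']
  rintro _ ⟨s, hs, rfl⟩
  simpa using key s hs

/-- Tietze–Nakajima: a connected closed set which resists touching has convex interior, provided
that locally any two points of the interior can be joined within the interior. -/
theorem ResistsTouching.convex_interior (hT : ResistsTouching r Ω) (hΩ : IsClosed Ω)
    (hconn : IsPreconnected Ω) (hcl : Ω ⊆ closure (interior Ω))
    (hloc : ∀ x ∈ Ω, ∃ V ∈ 𝓝 x, ∀ a ∈ V ∩ interior Ω, ∀ b ∈ V ∩ interior Ω,
      segment ℝ a b ⊆ interior Ω) : Convex ℝ (interior Ω) := by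
  rw [convex_iff_segment_subset]
  -- The relation concerns neighbourhoods because `x` and `y` may be boundary points; transitivity
  -- passes through an interior point close to the middle one.
  have (x y : E) (hx : x ∈ Ω) (hy : y ∈ Ω) := hconn.induction₂ (fun x y => ∃ V ∈ 𝓝 x, ∃ W ∈ 𝓝 y, ∀ a ∈ V ∩ interior Ω,
    ∀ b ∈ W ∩ interior Ω, segment ℝ a b ⊆ interior Ω) ?_ ?_ ?_ hx hy
  · intro a ha b hb
    obtain ⟨V, hV, W, hW, h⟩ := this a b (interior_subset ha) (interior_subset hb)
    exact h a ⟨mem_of_mem_nhds hV, ha⟩ b ⟨mem_of_mem_nhds hW, hb⟩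
  · intro x hx
    obtain ⟨V, hV, h⟩ := hloc x hx
    refine Eventually.filter_mono nhdsWithin_le_nhds ?_
    filter_upwards [eventually_mem_nhds_iff.2 hV] with y hy
    exact ⟨V, hV, V, hy, h⟩
  · rintro x y z - hy - ⟨V, hV, W, hW, h⟩ ⟨W', hW', Z, hZ, h'⟩
    obtain ⟨b, hb, hbi⟩ := mem_closure_iff_nhds.1 (hcl hy) _ (inter_mem hW hW')
    exact ⟨V, hV, Z, hZ, fun a ha c hc =>
      hT.segment_trans hΩ (h a ha b ⟨hb.1, hbi⟩) (h' b ⟨hb.2, hbi⟩ c hc)⟩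
  · rintro x y - - ⟨V, hV, W, hW, h⟩
    exact ⟨W, hW, V, hV, fun a ha b hb => by rw [segment_symm]; exact h b hb a ha⟩

end Segments

/-! ### Circular arcs of radius greater than `r` -/

section Arcs

open Real

variable {E : Type*} [NormedAddCommGroup E] [InnerProductSpace ℝ E] {Ω : Set E} {r : ℝ}

theorem norm_smul_add_smul_eq_one {u v : E} (hu : ‖u‖ = 1) (hv : ‖v‖ = 1) (huv : inner ℝ u v = 0)
    {α β : ℝ} (h : α ^ 2 + β ^ 2 = 1) : ‖α • u + β • v‖ = 1 := by
  have : ‖α • u + β • v‖ ^ 2 = 1 := by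
    rw [norm_add_sq_real, inner_smul_left, inner_smul_right, huv, norm_smul, norm_smul, hu, hv]
    simpa using h
  nlinarith [norm_nonneg (α • u + β • v)]

/-- At unit angular speed both velocity and acceleration have norm `R`, so the touching condition is
`r * R < R ^ 2`. -/
theorem ResistsTouching.circle (hT : ResistsTouching r Ω) (hr : 0 < r) {c u v : E} {R θ : ℝ}
    (hu : ‖u‖ = 1) (hv : ‖v‖ = 1) (huv : inner ℝ u v = 0) (hR : r < R)
    (hin : ∀ᶠ φ in 𝓝 θ, c + R • (cos φ • u + sin φ • v) ∈ Ω) :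
    c + R • (cos θ • u + sin θ • v) ∈ interior Ω := by
  have hR0 : 0 < R := hr.trans hR
  have dc (s : ℝ) : HasDerivAt (fun s => cos (θ + s)) (-sin (θ + s)) s := by
    simpa using ((hasDerivAt_id s).const_add θ).cos
  have ds (s : ℝ) : HasDerivAt (fun s => sin (θ + s)) (cos (θ + s)) s := by
    simpa using ((hasDerivAt_id s).const_add θ).sin
  have key := hT (fun s => c + R • (cos (θ + s) • u + sin (θ + s) • v))
    (fun s => R • ((-sin (θ + s)) • u + cos (θ + s) • v))
    (R • ((-cos (θ + 0)) • u + (-sin (θ + 0)) • v))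
    (fun s => ((((dc s).smul_const u).add ((ds s).smul_const v)).const_smul R).const_add c)
    ((((ds 0).neg.smul_const u).add ((dc 0).smul_const v)).const_smul R) ?_ ?_
  · simpa using key
  · rw [norm_smul, norm_smul, norm_smul_add_smul_eq_one hu hv huv,
      norm_smul_add_smul_eq_one hu hv huv, norm_eq_abs, abs_of_pos hR0]
    · nlinarith
    · rw [neg_sq, sin_sq_add_cos_sq]
    · rw [neg_sq, neg_sq, cos_sq_add_sin_sq]
  · have : Tendsto (fun s => θ + s) (𝓝 0) (𝓝 θ) := by
      have : ContinuousAt (fun s => θ + s) 0 := by fun_prop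
      simpa [ContinuousAt] using this
    exact this.eventually hin

/-- The circular arc from `m - h • v` to `m + h • v` which bulges towards `u`; here `k` is the
tangent of a quarter of its angle, and `s ∈ [-1, 1]` is the parameter. -/
noncomputable def circularArc (m u v : E) (h k s : ℝ) : E :=
  m + (h / (1 + s ^ 2 * k ^ 2)) • ((s * (1 + k ^ 2)) • v + (k * (1 - s ^ 2)) • u)

/-- The half-angle substitution exhibits the circle, of radius `h * (1 + k ^ 2) / (2 * k)`. The
rational form extends continuously to `k = 0`, where the arc is the chord. -/
theorem circularArc_tan {m u v : E} {h k φ : ℝ} (hk : k ≠ 0) (hφ : cos φ ≠ 0) :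
    circularArc m u v h k (tan φ / k) = (m - (h * (1 - k ^ 2) / (2 * k)) • u) +
      (h * (1 + k ^ 2) / (2 * k)) • (cos (2 * φ) • u + sin (2 * φ) • v) := by
  have e1 : h / (1 + (tan φ / k) ^ 2 * k ^ 2) = h * cos φ ^ 2 := by
    rw [div_pow, div_mul_cancel₀ _ (pow_ne_zero 2 hk), tan_eq_sin_div_cos]
    have : 1 + (sin φ / cos φ) ^ 2 = 1 / cos φ ^ 2 := by
      field_simp
      exact cos_sq_add_sin_sq φ
    rw [this]
    field_simp
  rw [circularArc, e1, cos_two_mul, sin_two_mul]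
  have e2 : h * cos φ ^ 2 * (tan φ / k * (1 + k ^ 2)) =
      h * (1 + k ^ 2) / (2 * k) * (2 * sin φ * cos φ) := by
    rw [tan_eq_sin_div_cos]; field_simp
  have e3 : h * cos φ ^ 2 * (k * (1 - (tan φ / k) ^ 2)) =
      - (h * (1 - k ^ 2) / (2 * k)) + h * (1 + k ^ 2) / (2 * k) * (2 * cos φ ^ 2 - 1) := by
    rw [tan_eq_sin_div_cos]; field_simp; rw [sin_sq]; ring
  rw [smul_add, smul_add, smul_smul, smul_smul, smul_smul, smul_smul, e2, e3, add_smul, neg_smul]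
  abel

theorem circularArc_neg_one (m u v : E) (h k : ℝ) : circularArc m u v h k (-1) = m - h • v := by
  have : h / (1 + k ^ 2) * (-1 * (1 + k ^ 2)) = -h := by field_simp
  rw [circularArc, neg_one_sq, one_mul, sub_self, mul_zero, zero_smul, add_zero, smul_smul, this,
    neg_smul, sub_eq_add_neg]

theorem circularArc_one (m u v : E) (h k : ℝ) : circularArc m u v h k 1 = m + h • v := by
  have : h / (1 + k ^ 2) * (1 + k ^ 2) = h := div_mul_cancel₀ _ (by positivity)
  simp [circularArc, smul_smul, this]

/-- The chord is bent with its ends fixed. The radius decreases in the parameter on `(0, 1]`, so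
`hhk`, which bounds the last radius, keeps all of them above `r`. -/
theorem ResistsTouching.circularArc_mem (hT : ResistsTouching r Ω) (hr : 0 < r) (hΩ : IsClosed Ω)
    {m u v : E} {h k : ℝ} (hu : ‖u‖ = 1) (hv : ‖v‖ = 1) (huv : inner ℝ u v = 0)
    (hk0 : 0 ≤ k) (hk1 : k ≤ 1) (hhk : 2 * r * k < h * (1 + k ^ 2))
    (hseg : ∀ s ∈ Icc (-1 : ℝ) 1, m + (h * s) • v ∈ interior Ω) :
    ∀ s ∈ Icc (-1 : ℝ) 1, circularArc m u v h k s ∈ interior Ω := by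
  refine sweep_subset_interior hΩ (F := fun k s => circularArc m u v h k s) ?_ isCompact_Icc hk0
    ?_ ?_
  · unfold circularArc
    refine continuous_const.add (Continuous.smul ?_ (by fun_prop))
    refine continuous_const.div (by fun_prop) fun x => ?_
    positivity
  · intro s hs
    simpa [circularArc, smul_smul] using hseg s hs
  · intro τ hτ hin s hs
    rcases eq_or_lt_of_le hs.1 with rfl | h0
    · rw [circularArc_neg_one]
      simpa [sub_eq_add_neg] using hseg (-1) hs
    rcases eq_or_lt_of_le hs.2 with rfl | h1
    · rw [circularArc_one]
      simpa using hseg 1 hs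
    have hτ0 : 0 < τ := hτ.1
    have hR : r < h * (1 + τ ^ 2) / (2 * τ) := by
      rw [lt_div_iff₀ (by positivity)]
      have a1 : k * (1 + τ ^ 2) - τ * (1 + k ^ 2) = (k - τ) * (1 - k * τ) := by ring
      have a2 : 0 ≤ (k - τ) * (1 - k * τ) :=
        mul_nonneg (sub_nonneg.2 hτ.2) (by nlinarith [hτ.2])
      have a3 : 2 * r * k * (1 + τ ^ 2) < h * (1 + k ^ 2) * (1 + τ ^ 2) :=
        mul_lt_mul_of_pos_right hhk (by positivity)
      have a4 : r * (τ * (1 + k ^ 2)) ≤ r * (k * (1 + τ ^ 2)) :=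
        mul_le_mul_of_nonneg_left (by linarith) hr.le
      have : r * (2 * τ) * (1 + k ^ 2) < h * (1 + τ ^ 2) * (1 + k ^ 2) := by linarith
      exact lt_of_mul_lt_mul_right this (by positivity)
    have hcos : cos (arctan (s * τ)) ≠ 0 := (cos_arctan_pos _).ne'
    have hts : tan (arctan (s * τ)) / τ = s := by
      rw [tan_arctan, mul_div_cancel_right₀ _ hτ0.ne']
    have key := hT.circle hr (c := m - (h * (1 - τ ^ 2) / (2 * τ)) • u)
      (θ := 2 * arctan (s * τ)) hu hv huv hR ?_
    · rw [← circularArc_tan hτ0.ne' hcos, hts] at key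
      exact key
    · have hc0 : ContinuousAt (fun φ : ℝ => φ / 2) (2 * arctan (s * τ)) := by fun_prop
      have hhalf : 2 * arctan (s * τ) / 2 = arctan (s * τ) := by ring
      have hc1 : ContinuousAt (fun φ : ℝ => cos (φ / 2)) (2 * arctan (s * τ)) := by fun_prop
      have hc2 : ContinuousAt (fun φ : ℝ => tan (φ / 2) / τ) (2 * arctan (s * τ)) := by
        refine ContinuousAt.div_const ?_ _
        refine ContinuousAt.comp (g := tan) ?_ hc0
        rw [hhalf]
        exact continuousAt_tan.2 hcos
      have h2 := hc2.eventually (Icc_mem_nhds (a := -1) (b := 1) (by simpa only [hhalf, hts] using h0)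
        (by simpa only [hhalf, hts] using h1))
      have h3 := hc1.eventually_ne (y := 0) (by simpa only [hhalf] using hcos)
      filter_upwards [h2, h3] with φ hφ2 hφ3
      have := hin _ hφ2
      rwa [circularArc_tan hτ0.ne' hφ3, mul_div_cancel₀ _ two_ne_zero] at this

end Arcs

/-! ### Inward directions and local connectedness of the interior -/

section Inward

variable {E : Type*} [NormedAddCommGroup E] [NormedSpace ℝ E] {g : E → ℝ} {p : E} {Ω : Set E}
  {r : ℝ}

theorem IsC11OnBall.mem_interior_of_neg {δ K : ℝ} (hg : IsC11OnBall g p δ K)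
    (hball : ∀ z ∈ Metric.ball p δ, (z ∈ Ω ↔ g z ≤ 0) ∧ (g z = 0 → z ∈ frontier Ω))
    {z : E} (hz : z ∈ Metric.ball p δ) (hgz : g z < 0) : z ∈ interior Ω := by
  rw [mem_interior_iff_mem_nhds]
  filter_upwards [(hg.hasFDerivAt z hz).continuousAt.eventually (gt_mem_nhds hgz),
    Metric.isOpen_ball.mem_nhds hz] with y hy hyb
  exact (hball y hyb).1.2 hy.le

theorem IsC11Domain.eventually_mem_interior (hΩ : IsC11Domain Ω g) (hp : p ∈ frontier Ω) {w : E}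
    (hw : fderiv ℝ g p w < 0) : ∀ᶠ t in 𝓝[>] (0 : ℝ), p + t • w ∈ interior Ω := by
  obtain ⟨δ, K, hg, hball⟩ := hΩ.exists_ball _ hp
  have hγ : HasDerivAt (fun t : ℝ => p + t • w) w 0 := by
    simpa using ((hasDerivAt_id (0 : ℝ)).smul_const w).const_add p
  have hγ0 : p + (0 : ℝ) • w = p := by simp
  have hd : HasDerivAt (fun t : ℝ => g (p + t • w)) (fderiv ℝ g p w) 0 := by
    exact (hg.hasFDerivAt _ hg.mem_ball).comp_hasDerivAt_of_eq 0 hγ hγ0.symm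
  have h1 := hd.tendsto_slope_zero_right
  have h2 : ∀ᶠ t in 𝓝[>] (0 : ℝ), p + t • w ∈ Metric.ball p δ :=
    (hγ.continuousAt.eventually (Metric.isOpen_ball.mem_nhds
      (by simpa using hg.pos))).filter_mono nhdsWithin_le_nhds
  filter_upwards [h1.eventually (gt_mem_nhds hw), h2, self_mem_nhdsWithin] with t ht ht2 ht0
  refine hg.mem_interior_of_neg hball ht2 ?_
  simp only [zero_add, hγ0, hΩ.eq_zero _ hp, sub_zero, smul_eq_mul] at ht
  by_contra hcon
  exact absurd ht (not_lt.2 (mul_nonneg (inv_nonneg.2 (le_of_lt ht0)) (not_lt.1 hcon)))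

theorem IsC11Domain.exists_inward (hΩ : IsC11Domain Ω g) (hp : p ∈ frontier Ω) :
    ∃ w, fderiv ℝ g p w < 0 := by
  obtain ⟨w, hw⟩ := ContinuousLinearMap.exists_ne_zero (hΩ.fderiv_ne_zero p hp)
  rcases lt_or_gt_of_ne hw with h | h
  · exact ⟨w, h⟩
  · exact ⟨-w, by simpa using h⟩

theorem IsC11Domain.subset_closure_interior (hΩ : IsC11Domain Ω g) :
    Ω ⊆ closure (interior Ω) := by
  intro p hp
  by_cases hi : p ∈ interior Ω
  · exact subset_closure hi
  have hpf : p ∈ frontier Ω := hΩ.isClosed.frontier_eq ▸ ⟨hp, hi⟩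
  obtain ⟨w, hw⟩ := hΩ.exists_inward hpf
  refine mem_closure_of_tendsto (f := fun t : ℝ => p + t • w) (b := 𝓝[>] 0) ?_
    (hΩ.eventually_mem_interior hpf hw)
  have : ContinuousAt (fun t : ℝ => p + t • w) 0 := by fun_prop
  simpa [ContinuousAt] using this.tendsto.mono_left nhdsWithin_le_nhds

/-- An inward translation carries all interior points near `p` into one small ball inside the
interior; two translation legs and a segment in that ball are then merged by `segment_trans`. -/
theorem IsC11Domain.locally_joined (hΩ : IsC11Domain Ω g) (hT : ResistsTouching r Ω)
    (hp : p ∈ Ω) : ∃ V ∈ 𝓝 p, ∀ a ∈ V ∩ interior Ω, ∀ b ∈ V ∩ interior Ω,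
      segment ℝ a b ⊆ interior Ω := by
  by_cases hi : p ∈ interior Ω
  · obtain ⟨ε, hε, hsub⟩ := Metric.isOpen_iff.1 isOpen_interior p hi
    exact ⟨_, Metric.ball_mem_nhds p hε, fun a ha b hb =>
      ((convex_ball p ε).segment_subset ha.1 hb.1).trans hsub⟩
  have hpf : p ∈ frontier Ω := hΩ.isClosed.frontier_eq ▸ ⟨hp, hi⟩
  obtain ⟨w, hw⟩ := hΩ.exists_inward hpf
  obtain ⟨δ, K, hg, hball⟩ := hΩ.exists_ball _ hpf
  -- With this tolerance the strict differentiability error is smaller than the decrease of `g`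
  -- along `w`, uniformly in the starting point.
  have hc : 0 < -fderiv ℝ g p w / (‖w‖ + 1) := div_pos (neg_pos.2 hw) (by positivity)
  have hstrict := hg.hasStrictFDerivAt.isLittleO.def hc
  rw [nhds_prod_eq] at hstrict
  obtain ⟨η, hη, hstrict⟩ := (Metric.nhds_basis_ball.prod_self.eventually_iff).1 hstrict
  have hdec {a : E} {s : ℝ} (ha : a ∈ Metric.ball p η) (has : a + s • w ∈ Metric.ball p η)
      (hs : 0 < s) : g (a + s • w) < g a := by
    have := hstrict (Set.mk_mem_prod has ha)
    simp only [add_sub_cancel_left, map_smul, norm_smul, Real.norm_eq_abs, abs_of_pos hs,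
      smul_eq_mul] at this
    have h1 : -fderiv ℝ g p w / (‖w‖ + 1) * (s * ‖w‖) < s * -fderiv ℝ g p w := by
      rw [div_mul_eq_mul_div, div_lt_iff₀ (by positivity)]
      nlinarith [mul_pos hs (neg_pos.2 hw)]
    linarith [le_abs_self (g (a + s • w) - g a - s * fderiv ℝ g p w)]
  obtain ⟨t, ht0, ht⟩ : ∃ t > 0, t * ‖w‖ < min η δ / 2 := by
    have hm : 0 < min η δ / 2 := half_pos (lt_min hη hg.pos)
    refine ⟨min η δ / 2 / (‖w‖ + 1), by positivity, ?_⟩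
    rw [div_mul_eq_mul_div, div_lt_iff₀ (by positivity)]
    nlinarith
  have hmove {a : E} {s : ℝ} (ha : a ∈ Metric.ball p (min η δ / 2)) (hs : s ∈ Icc 0 t) :
      a + s • w ∈ Metric.ball p (min η δ) := by
    rw [mem_ball_iff_norm] at ha ⊢
    calc ‖a + s • w - p‖ = ‖(a - p) + s • w‖ := by congr 1; abel
      _ ≤ ‖a - p‖ + ‖s • w‖ := norm_add_le _ _
      _ < min η δ / 2 + min η δ / 2 := by
        refine add_lt_add ha (lt_of_le_of_lt ?_ ht)
        rw [norm_smul, Real.norm_eq_abs, abs_of_nonneg hs.1]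
        exact mul_le_mul_of_nonneg_right hs.2 (norm_nonneg _)
      _ = min η δ := add_halves _
  have hinner {a : E} {s : ℝ} (ha : a ∈ Metric.ball p (min η δ / 2)) (hga : g a ≤ 0)
      (hs : s ∈ Ioc 0 t) : a + s • w ∈ interior Ω := by
    have h0 : a ∈ Metric.ball p (min η δ) := by simpa using hmove ha ⟨le_rfl, ht0.le⟩
    have h1 := hmove ha ⟨hs.1.le, hs.2⟩
    refine hg.mem_interior_of_neg hball (Metric.ball_subset_ball (min_le_right _ _) h1) ?_
    exact (hdec (Metric.ball_subset_ball (min_le_left _ _) h0)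
      (Metric.ball_subset_ball (min_le_left _ _) h1) hs.1).trans_le hga
  have hm : 0 < min η δ / 2 := half_pos (lt_min hη hg.pos)
  have hpt : p + t • w ∈ interior Ω :=
    hinner (Metric.mem_ball_self hm) (hΩ.eq_zero p hpf).le ⟨ht0, le_rfl⟩
  obtain ⟨ε, hε, hsub⟩ := Metric.isOpen_iff.1 isOpen_interior _ hpt
  refine ⟨Metric.ball p (min ε (min η δ / 2)), Metric.ball_mem_nhds _ (lt_min hε hm), ?_⟩
  have hleg {a : E} (ha : a ∈ Metric.ball p (min ε (min η δ / 2)) ∩ interior Ω) :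
      segment ℝ a (a + t • w) ⊆ interior Ω := by
    have ha1 := Metric.ball_subset_ball (min_le_right _ _) ha.1
    have ha2 : a ∈ Metric.ball p δ := Metric.ball_subset_ball
      ((half_le_self (lt_min hη hg.pos).le).trans (min_le_right _ _)) ha1
    have hga : g a ≤ 0 := (hball a ha2).1.1 (interior_subset ha.2)
    rw [segment_eq_image']
    rintro _ ⟨s, hs, rfl⟩
    rcases eq_or_lt_of_le hs.1 with rfl | h0
    · simpa using ha.2
    · have := hinner (s := s * t) ha1 hga ⟨by positivity, by nlinarith [hs.2]⟩
      simpa [smul_smul] using this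
  have hshift {a : E} (ha : a ∈ Metric.ball p (min ε (min η δ / 2))) :
      a + t • w ∈ Metric.ball (p + t • w) ε := by
    simpa using Metric.ball_subset_ball (min_le_left _ _) ha
  intro a ha b hb
  refine hT.segment_trans hΩ.isClosed (hleg ha) (hT.segment_trans hΩ.isClosed
    (((convex_ball _ ε).segment_subset (hshift ha.1) (hshift hb.1)).trans hsub) ?_)
  rw [segment_symm]
  exact hleg hb

end Inward

/-! ### Semicircles, growing spheres and the initial direction of an arc -/

section Support

variable {E : Type*} [NormedAddCommGroup E] [InnerProductSpace ℝ E] {g : E → ℝ} {Ω : Set E}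
  {r : ℝ}

/-- `horth` is needed when `e` is parallel to `v`; this excludes dimension one. -/
theorem exists_orthogonal_decomposition (horth : ∀ e : E, ∃ T : E, ‖T‖ = 1 ∧ inner ℝ e T = 0)
    {v e : E} (hv : ‖v‖ = 1) (he : ‖e‖ = 1) :
    ∃ (u : E) (β : ℝ), ‖u‖ = 1 ∧ inner ℝ u v = 0 ∧ 0 ≤ β ∧ e = inner ℝ v e • v + β • u ∧
      inner ℝ v e ^ 2 + β ^ 2 = 1 := by
  have hvv : inner ℝ v v = 1 := by rw [real_inner_self_eq_norm_sq, hv, one_pow]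
  have hperp : inner ℝ (e - inner ℝ v e • v) v = 0 := by
    rw [inner_sub_left, inner_smul_left, hvv, real_inner_comm]
    simp
  have hpyth : inner ℝ v e ^ 2 + ‖e - inner ℝ v e • v‖ ^ 2 = 1 := by
    rw [norm_sub_sq_real, inner_smul_right, norm_smul, hv, he, real_inner_comm v e,
      Real.norm_eq_abs, mul_one, sq_abs]
    ring
  by_cases h : e - inner ℝ v e • v = 0
  · obtain ⟨T, hT1, hT2⟩ := horth v
    refine ⟨T, 0, hT1, by rw [real_inner_comm, hT2], le_rfl, ?_, ?_⟩
    · simpa [sub_eq_zero] using h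
    · simpa [h] using hpyth
  · refine ⟨‖e - inner ℝ v e • v‖⁻¹ • (e - inner ℝ v e • v), ‖e - inner ℝ v e • v‖, ?_, ?_,
      norm_nonneg _, ?_, hpyth⟩
    · exact norm_smul_inv_norm h
    · rw [inner_smul_left, hperp, mul_zero]
    · rw [smul_smul, mul_inv_cancel₀ (norm_ne_zero_iff.2 h), one_smul]
      abel

theorem mem_of_convex_of_endpoints {C : Set E} (hC : Convex ℝ C) {m v : E} {h : ℝ}
    (h0 : m - h • v ∈ C) (h1 : m + h • v ∈ C) : ∀ s ∈ Icc (-1 : ℝ) 1, m + (h * s) • v ∈ C := by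
  intro s hs
  have := hC h0 h1 (a := (1 - s) / 2) (b := (1 + s) / 2) (by linarith [hs.2]) (by linarith [hs.1])
    (by ring)
  convert this using 1
  module

/-- A set which resists touching and has two interior points at distance more than `2 * r` is the
whole space. -/
theorem ResistsTouching.interior_eq_univ [ProperSpace E] (hT : ResistsTouching r Ω) (hr : 0 < r)
    (hΩ : IsClosed Ω) (hconv : Convex ℝ (interior Ω))
    (horth : ∀ e : E, ∃ T : E, ‖T‖ = 1 ∧ inner ℝ e T = 0) {m v : E} {h : ℝ} (hv : ‖v‖ = 1)
    (hh : r < h) (h0 : m - h • v ∈ interior Ω) (h1 : m + h • v ∈ interior Ω) :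
    interior Ω = univ := by
  have hseg := mem_of_convex_of_endpoints hconv h0 h1
  -- The semicircles (`k = 1`) over the given diameter, bulging in all directions, cover the sphere
  -- of radius `h > r`; `α / (1 + β)` is the half-angle parameter of `e`.
  have hsphere : ∀ e ∈ Metric.sphere (0 : E) 1, m + h • e ∈ interior Ω := by
    intro e he
    obtain ⟨u, β, hu, huv, hβ, hdec, hsq⟩ :=
      exists_orthogonal_decomposition horth hv (mem_sphere_zero_iff_norm.1 he)
    set α : ℝ := inner ℝ v e
    have hβ1 : 0 < 1 + β := by linarith
    have hs : α / (1 + β) ∈ Icc (-1 : ℝ) 1 := by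
      have : |α| ≤ 1 := by
        rw [← sq_le_one_iff_abs_le_one]; nlinarith [sq_nonneg β]
      rw [mem_Icc, ← abs_le, abs_div, abs_of_pos hβ1, div_le_one hβ1]
      linarith
    have key := hT.circularArc_mem hr hΩ hu hv huv zero_le_one le_rfl (by linarith) hseg _ hs
    have e1 : 1 + (α / (1 + β)) ^ 2 * 1 ^ 2 = 2 / (1 + β) := by
      field_simp; nlinarith
    have e2 : h / (2 / (1 + β)) * (α / (1 + β) * (1 + 1 ^ 2)) = h * α := by
      field_simp; ring
    have e3 : h / (2 / (1 + β)) * (1 * (1 - (α / (1 + β)) ^ 2)) = h * β := by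
      field_simp
      have : α ^ 2 = (1 - β) * (1 + β) := by linarith
      rw [this]; ring
    rw [circularArc, e1, smul_add, smul_smul, smul_smul, e2, e3] at key
    rw [hdec, smul_add, smul_smul, smul_smul]
    exact key
  -- Every point of a larger sphere lies on a great circle of radius greater than `r`, so the
  -- growing sphere never touches the boundary.
  have hgrow {ρ : ℝ} (hρ : h ≤ ρ) : ∀ e ∈ Metric.sphere (0 : E) 1, m + ρ • e ∈ interior Ω := by
    refine sweep_subset_interior hΩ (F := fun ρ e => m + ρ • e) (by fun_prop)
      (isCompact_sphere 0 1) hρ hsphere ?_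
    intro τ hτ hin e he
    have he1 : ‖e‖ = 1 := mem_sphere_zero_iff_norm.1 he
    obtain ⟨T, hT1, hT2⟩ := horth e
    have := hT.circle hr (c := m) (θ := 0) he1 hT1 hT2 (hh.trans hτ.1)
      (Eventually.of_forall fun φ => hin _ (mem_sphere_zero_iff_norm.2
        (norm_smul_add_smul_eq_one he1 hT1 hT2 (Real.cos_sq_add_sin_sq φ))))
    simpa using this
  rw [eq_univ_iff_forall]
  intro z
  obtain ⟨e, he, hz⟩ : ∃ e ∈ Metric.sphere (0 : E) 1, z = m + ‖z - m‖ • e := by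
    rcases eq_or_ne z m with rfl | hzm
    · exact ⟨v, mem_sphere_zero_iff_norm.2 hv, by simp⟩
    · have hne : ‖z - m‖ ≠ 0 := norm_ne_zero_iff.2 (sub_ne_zero.2 hzm)
      refine ⟨‖z - m‖⁻¹ • (z - m), mem_sphere_zero_iff_norm.2
        (norm_smul_inv_norm (sub_ne_zero.2 hzm)), ?_⟩
      rw [smul_smul, mul_inv_cancel₀ hne, one_smul]; abel
  rcases le_total h ‖z - m‖ with hle | hle
  · rw [hz]; exact hgrow hle e he
  · have hh0 : 0 < h := hr.trans hh
    have hneg := hsphere (-e) (by simpa using he)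
    rw [smul_neg, ← sub_eq_add_neg] at hneg
    have := mem_of_convex_of_endpoints hconv hneg (hsphere e he) (‖z - m‖ / h)
      ⟨by linarith [div_nonneg (norm_nonneg (z - m)) hh0.le], (div_le_one hh0).2 hle⟩
    rw [mul_div_cancel₀ _ hh0.ne'] at this
    rwa [hz]

/-- The coefficients are `h` times the cosine and sine of `2 * arctan k`, the angle between chord
and arc at the starting point. -/
theorem hasDerivAt_circularArc (m u v : E) (h k : ℝ) :
    HasDerivAt (fun t => circularArc m u v h k (-1 + t))
      ((h * ((1 - k ^ 2) / (1 + k ^ 2))) • v + (h * (2 * k / (1 + k ^ 2))) • u) 0 := by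
  have hid : HasDerivAt (fun t : ℝ => -1 + t) 1 0 := (hasDerivAt_id (0 : ℝ)).const_add (-1)
  have hq : HasDerivAt (fun t : ℝ => 1 + (-1 + t) ^ 2 * k ^ 2) (-(2 * k ^ 2)) 0 := by
    refine (((hid.fun_pow 2).mul_const (k ^ 2)).const_add 1).congr_deriv ?_
    simp
  have hq0 : (1 + (-1 + (0 : ℝ)) ^ 2 * k ^ 2) ≠ 0 := by positivity
  have hdiv : HasDerivAt (fun t : ℝ => h / (1 + (-1 + t) ^ 2 * k ^ 2))
      (h * (2 * k ^ 2) / (1 + k ^ 2) ^ 2) 0 := by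
    refine ((hasDerivAt_const (0 : ℝ) h).fun_div hq hq0).congr_deriv ?_
    simp
  have h1 : HasDerivAt (fun t : ℝ => h / (1 + (-1 + t) ^ 2 * k ^ 2) * ((-1 + t) * (1 + k ^ 2)))
      (h * ((1 - k ^ 2) / (1 + k ^ 2))) 0 := by
    refine (hdiv.fun_mul (hid.mul_const (1 + k ^ 2))).congr_deriv ?_
    field_simp
    ring
  have h2 : HasDerivAt (fun t : ℝ => h / (1 + (-1 + t) ^ 2 * k ^ 2) * (k * (1 - (-1 + t) ^ 2)))
      (h * (2 * k / (1 + k ^ 2))) 0 := by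
    refine (hdiv.fun_mul (((hid.fun_pow 2).const_sub 1).const_mul k)).congr_deriv ?_
    norm_num
    field_simp
  have h3 := ((h1.smul_const v).fun_add (h2.smul_const u)).const_add m
  simpa only [circularArc, smul_add, smul_smul] using h3

end Support

/-! ### Blaschke's rolling theorem -/

section SupportingBall

variable {E : Type*} [NormedAddCommGroup E] [InnerProductSpace ℝ E] {g : E → ℝ} {Ω : Set E}
  {r : ℝ}

theorem norm_gradient_eq [CompleteSpace E] (g : E → ℝ) (p : E) :
    ‖gradient g p‖ = ‖fderiv ℝ g p‖ := by
  simp [gradient]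

/-- Sweeping needs endpoints in the interior; a configuration starting on the boundary is pushed
inward by `t • N` and recovered as `t → 0`. -/
theorem IsClosed.mem_of_eventually_sub_smul_mem (hΩ : IsClosed Ω) {z N : E}
    (h : ∀ᶠ t in 𝓝[>] (0 : ℝ), z - t • N ∈ interior Ω) : z ∈ Ω := by
  refine hΩ.mem_of_tendsto (f := fun t : ℝ => z - t • N) (b := 𝓝[>] 0) ?_
    (h.mono fun t ht => interior_subset ht)
  have : ContinuousAt (fun t : ℝ => z - t • N) 0 := by fun_prop
  simpa [ContinuousAt] using this.tendsto.mono_left nhdsWithin_le_nhds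

/-- Blaschke's rolling theorem: under the curvature bound, `Ω` is contained in the ball of radius
`r` which is tangent to its boundary at `p`. -/
theorem IsC11Domain.supporting_ball [ProperSpace E] [CompleteSpace E] (hΩ : IsC11Domain Ω g)
    (hr : 0 < r) (hc : HasCurvatureBound r Ω g) (hconn : IsPreconnected Ω)
    (horth : ∀ e : E, ∃ T : E, ‖T‖ = 1 ∧ inner ℝ e T = 0) {p : E} (hp : p ∈ frontier Ω) {q : E}
    (hq : q ∈ Ω) : ‖fderiv ℝ g p‖ * ‖q - p‖ ^ 2 + 2 * r * fderiv ℝ g p (q - p) ≤ 0 := by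
  have hT := hΩ.resistsTouching hr hc
  have hconv := hT.convex_interior hΩ.isClosed hconn hΩ.subset_closure_interior
    (fun x hx => hΩ.locally_joined hT hx)
  have hclosed : IsClosed
      {q | ‖fderiv ℝ g p‖ * ‖q - p‖ ^ 2 + 2 * r * fderiv ℝ g p (q - p) ≤ 0} :=
    isClosed_le (by fun_prop) continuous_const
  refine closure_minimal ?_ hclosed (hΩ.subset_closure_interior hq)
  clear hq q
  intro q hq
  rw [mem_ofPred_eq]
  by_contra! hF
  set N := gradient g p with hNdef
  have hNw (w : E) : fderiv ℝ g p w = inner ℝ N w := inner_gradient_left.symm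
  have hNn : ‖fderiv ℝ g p‖ = ‖N‖ := (norm_gradient_eq g p).symm
  have hN0 : 0 < ‖N‖ := hNn ▸ norm_pos_iff.2 (hΩ.fderiv_ne_zero p hp)
  have hin : ∀ᶠ t in 𝓝[>] (0 : ℝ), p - t • N ∈ interior Ω ∧ q - t • N ∈ interior Ω := by
    refine Eventually.and ?_ ?_
    · have := hΩ.eventually_mem_interior hp (w := -N) (by
        rw [hNw, inner_neg_right, real_inner_self_eq_norm_sq]
        exact neg_neg_of_pos (pow_pos hN0 2))
      simpa [sub_eq_add_neg] using this
    · have : ContinuousAt (fun t : ℝ => q - t • N) 0 := by fun_prop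
      exact (this.eventually (isOpen_interior.mem_nhds (by simpa using hq))).filter_mono
        nhdsWithin_le_nhds
  have hpq : q ≠ p := by
    rintro rfl
    exact hp.2 hq
  set d := q - p with hd
  have hd0 : 0 < ‖d‖ := norm_pos_iff.2 (sub_ne_zero.2 hpq)
  set v := ‖d‖⁻¹ • d with hvdef
  have hv : ‖v‖ = 1 := norm_smul_inv_norm (norm_pos_iff.1 hd0)
  have hdv : d = ‖d‖ • v := by rw [hvdef, smul_smul, mul_inv_cancel₀ hd0.ne', one_smul]
  clear_value v
  set ν := ‖N‖⁻¹ • N with hνdef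
  have hν : ‖ν‖ = 1 := norm_smul_inv_norm (norm_pos_iff.1 hN0)
  have hNν : N = ‖N‖ • ν := by rw [hνdef, smul_smul, mul_inv_cancel₀ hN0.ne', one_smul]
  clear_value ν
  set a : ℝ := inner ℝ v ν with hadef
  have hNd : fderiv ℝ g p d = ‖N‖ * ‖d‖ * a := by
    rw [hNw, hadef, real_inner_comm ν v]
    conv_lhs => rw [hNν, hdv]
    rw [inner_smul_left, inner_smul_right]
    simp [mul_assoc]
  have hF' : 0 < ‖d‖ + 2 * r * a := by
    rw [hNn, hNd] at hF
    have : 0 < (‖N‖ * ‖d‖) * (‖d‖ + 2 * r * a) := by linarith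
    exact pos_of_mul_pos_right this (by positivity)
  -- midpoint and half-length
  set m := p + (1 / 2 : ℝ) • d with hmdef
  have hends (t : ℝ) : (m - t • N) - (‖d‖ / 2) • v = p - t • N ∧
      (m - t • N) + (‖d‖ / 2) • v = q - t • N := by
    have e : (‖d‖ / 2) • v = (1 / 2 : ℝ) • d := by
      conv_rhs => rw [hdv]
      rw [smul_smul]; congr 1; ring
    rw [e, hmdef, hd]
    constructor <;> module
  have hshort : ‖d‖ / 2 ≤ r := by
    by_contra! hlong
    obtain ⟨t, ht1, ht2⟩ := hin.exists
    rw [← (hends t).1] at ht1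
    rw [← (hends t).2] at ht2
    have := hT.interior_eq_univ hr hΩ.isClosed hconv horth hv hlong ht1 ht2
    exact hp.2 (this ▸ mem_univ p)
  have hseg (t : ℝ) (h1 : p - t • N ∈ interior Ω) (h2 : q - t • N ∈ interior Ω) :
      ∀ s ∈ Icc (-1 : ℝ) 1, (m - t • N) + (‖d‖ / 2 * s) • v ∈ interior Ω :=
    mem_of_convex_of_endpoints hconv ((hends t).1 ▸ h1) ((hends t).2 ▸ h2)
  -- If `a > 0`, the chord itself already points outward at `p`, against convexity.
  rcases lt_or_ge 0 a with ha | ha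
  · have hγ : HasDerivAt (fun t : ℝ => p + t • d) d 0 := by
      simpa using ((hasDerivAt_id (0 : ℝ)).smul_const d).const_add p
    have hp' : p + (0 : ℝ) • d ∈ frontier Ω := by simpa using hp
    have hout := hΩ.eventually_notMem hp' hγ (by
      rw [zero_smul, add_zero, hNd]; positivity)
    obtain ⟨s, hs, hs1⟩ := (hout.and (Ioc_mem_nhdsGT (zero_lt_one' ℝ))).exists
    refine hs (hΩ.isClosed.mem_of_eventually_sub_smul_mem (N := N) ?_)
    filter_upwards [hin] with t ht
    have := hconv ht.1 ht.2 (sub_nonneg.2 hs1.2) hs1.1.le (by ring)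
    convert this using 1
    rw [hd]; module
  · obtain ⟨u, β, hu, huv, hβ, hdec, hsq⟩ := exists_orthogonal_decomposition horth hv hν
    rw [← hadef] at hdec hsq
    -- `σ` is the sine of the angle between arc and chord at `p`. The upper bound makes the radius
    -- `‖d‖ / (2 * σ)` exceed `r`; the lower bound makes the arc start outward.
    obtain ⟨σ, hσ1, hσ2⟩ : ∃ σ, -a < σ ∧ σ < ‖d‖ / (2 * r) :=
      exists_between (by rw [lt_div_iff₀ (by positivity)]; linarith)
    have hσr : σ * (2 * r) < ‖d‖ := (lt_div_iff₀ (by positivity)).1 hσ2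
    have hσ0 : 0 < σ := by linarith
    have hσle : σ < 1 := hσ2.trans_le ((div_le_one (by positivity)).2 (by linarith))
    set C := Real.sqrt (1 - σ ^ 2) with hCdef
    have hC2 : C ^ 2 = 1 - σ ^ 2 := Real.sq_sqrt (by nlinarith)
    have hC0 : 0 ≤ C := Real.sqrt_nonneg _
    have hC1 : 0 < 1 + C := by linarith
    set k := σ / (1 + C) with hkdef
    have hk0 : 0 ≤ k := by positivity
    have hk1 : k ≤ 1 := (div_le_one hC1).2 (by linarith)
    have hkk : 1 + k ^ 2 = 2 / (1 + C) := by
      rw [hkdef]; field_simp; linarith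
    have hks : 2 * k / (1 + k ^ 2) = σ := by
      rw [hkk, hkdef]; field_simp
    have hkc : (1 - k ^ 2) / (1 + k ^ 2) = C := by
      have : 1 - k ^ 2 = 2 - (1 + k ^ 2) := by ring
      rw [this, hkk]; field_simp; ring
    have hhk : 2 * r * k < ‖d‖ / 2 * (1 + k ^ 2) := by
      rw [hkk, hkdef]
      have : 2 * r * (σ / (1 + C)) = σ * (2 * r) / (1 + C) := by ring
      rw [this]
      have : ‖d‖ / 2 * (2 / (1 + C)) = ‖d‖ / (1 + C) := by ring
      rw [this]
      exact div_lt_div_of_pos_right hσr hC1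
    have harc : ∀ s ∈ Icc (-1 : ℝ) 1, circularArc m u v (‖d‖ / 2) k s ∈ Ω := by
      intro s hs
      refine hΩ.isClosed.mem_of_eventually_sub_smul_mem (N := N) ?_
      filter_upwards [hin] with t ht
      have := hT.circularArc_mem hr hΩ.isClosed hu hv huv hk0 hk1 hhk (hseg t ht.1 ht.2) s hs
      convert this using 1
      rw [circularArc, circularArc]; abel
    have hder := hasDerivAt_circularArc m u v (‖d‖ / 2) k
    have hstart : circularArc m u v (‖d‖ / 2) k (-1 + 0) = p := by
      rw [add_zero, circularArc_neg_one]
      simpa using (hends 0).1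
    have huu : inner ℝ u u = (1 : ℝ) := by rw [real_inner_self_eq_norm_sq, hu, one_pow]
    have hNv : inner ℝ N v = ‖N‖ * a := by
      conv_lhs => rw [hNν]
      rw [inner_smul_left, hadef, real_inner_comm]; simp
    have hNu : inner ℝ N u = ‖N‖ * β := by
      have : inner ℝ ν u = β := by
        rw [hdec, inner_add_left, inner_smul_left, inner_smul_left, huu, real_inner_comm, huv]
        simp
      conv_lhs => rw [hNν]
      rw [inner_smul_left, this]; simp
    -- The initial velocity is a positive multiple of `C • v + σ • u`, and `ν = a • v + β • u`; the
    -- claim is that their inner product is positive.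
    have hcmp : C * -a < σ * β := by
      refine lt_of_pow_lt_pow_left₀ 2 (by positivity) ?_
      have : β ^ 2 = 1 - a ^ 2 := by linarith
      rw [mul_pow, mul_pow, hC2, this, neg_sq]
      nlinarith
    have hout := hΩ.eventually_notMem (by rw [hstart]; exact hp) hder (by
      rw [hstart, hks, hkc, hNw, inner_add_right, inner_smul_right, inner_smul_right, hNv, hNu]
      have : ‖d‖ / 2 * C * (‖N‖ * a) + ‖d‖ / 2 * σ * (‖N‖ * β) =
        ‖d‖ / 2 * ‖N‖ * (σ * β - C * -a) := by ring
      rw [this]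
      exact mul_pos (by positivity) (sub_pos.2 hcmp))
    obtain ⟨s, hs, hs1⟩ := (hout.and (Ioc_mem_nhdsGT (zero_lt_one' ℝ))).exists
    exact hs (harc _ ⟨by linarith [hs1.1], by linarith [hs1.2]⟩)

/-- The supporting ball property, expressed through the centre of the ball. -/
theorem norm_sub_center_sq [CompleteSpace E] (g : E → ℝ) {p : E} (hN : fderiv ℝ g p ≠ 0)
    (r : ℝ) (q : E) :
    ‖fderiv ℝ g p‖ * (‖q - (p - (r / ‖fderiv ℝ g p‖) • gradient g p)‖ ^ 2 - r ^ 2) =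
      ‖fderiv ℝ g p‖ * ‖q - p‖ ^ 2 + 2 * r * fderiv ℝ g p (q - p) := by
  have hN0 : ‖fderiv ℝ g p‖ ≠ 0 := norm_ne_zero_iff.2 hN
  have e : q - (p - (r / ‖fderiv ℝ g p‖) • gradient g p) =
      (q - p) + (r / ‖fderiv ℝ g p‖) • gradient g p := by abel
  rw [e, norm_add_sq_real, inner_smul_right, real_inner_comm, inner_gradient_left, norm_smul,
    norm_gradient_eq, mul_pow, Real.norm_eq_abs, sq_abs]
  field_simp
  ring

end SupportingBall

/-! ### Tangent balls and `r`-convexity -/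

section Lens

variable {n : ℕ} {g : EuclideanSpace ℝ (Fin n) → ℝ} {Ω : Set (EuclideanSpace ℝ (Fin n))} {r : ℝ}

/-- If `Ω` lies in the tangent ball of radius `r` at each boundary point, it is `r`-convex. -/
theorem IsC11Domain.isRConvex (hΩ : IsC11Domain Ω g) (hr : 0 < r)
    (hsupp : ∀ p ∈ frontier Ω, ∀ q ∈ Ω,
      ‖fderiv ℝ g p‖ * ‖q - p‖ ^ 2 + 2 * r * fderiv ℝ g p (q - p) ≤ 0) : IsRConvex r Ω := by
  intro x hx y hy z hz
  by_contra hzΩ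
  set S := (fun s : ℝ => x + s • (z - x)) ⁻¹' Ω ∩ Icc 0 1 with hS
  have hScomp : IsCompact S := (isCompact_Icc.inter_left (hΩ.isClosed.preimage (by fun_prop)))
  obtain ⟨s, hs, hmax⟩ := hScomp.exists_isGreatest ⟨0, by simpa using hx, by simp⟩
  set p := x + s • (z - x) with hp
  have hpΩ : p ∈ Ω := hs.1
  have hs1 : s < 1 := by
    refine lt_of_le_of_ne hs.2.2 ?_
    rintro rfl
    exact hzΩ (by simpa [hp] using hpΩ)
  have hzp : z - p = (1 - s) • (z - x) := by rw [hp]; module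
  have hafter : ∀ t ∈ Ioc (0 : ℝ) 1, p + t • (z - p) ∉ Ω := by
    intro t ht hmem
    have hpos : 0 < t * (1 - s) := mul_pos ht.1 (sub_pos.2 hs1)
    have : s + t * (1 - s) ∈ S := by
      refine ⟨?_, by linarith [hs.2.1], by nlinarith [ht.2]⟩
      rw [mem_preimage]
      convert hmem using 1
      rw [hzp, hp]; module
    linarith [hmax this]
  have hpf : p ∈ frontier Ω := by
    rw [hΩ.isClosed.frontier_eq]
    refine ⟨hpΩ, fun hi => ?_⟩
    have : ContinuousAt (fun t : ℝ => p + t • (z - p)) 0 := by fun_prop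
    have h1 := (this.eventually (isOpen_interior.mem_nhds (by simpa using hi))).filter_mono
      (nhdsWithin_le_nhds (s := Ioi 0))
    obtain ⟨t, ht, ht'⟩ := (h1.and (Ioc_mem_nhdsGT (zero_lt_one' ℝ))).exists
    exact hafter t ht' (interior_subset ht)
  -- Beyond `p` the segment stays outside `Ω`, so it cannot point inward.
  have hout : 0 ≤ fderiv ℝ g p (z - p) := by
    by_contra! hneg
    obtain ⟨t, ht, ht'⟩ := ((hΩ.eventually_mem_interior hpf hneg).and
      (Ioc_mem_nhdsGT (zero_lt_one' ℝ))).exists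
    exact hafter t ht' (interior_subset ht)
  have hN0 : 0 < ‖fderiv ℝ g p‖ := norm_pos_iff.2 (hΩ.fderiv_ne_zero p hpf)
  have hiff (q) : q ∈ Metric.closedBall (p - (r / ‖fderiv ℝ g p‖) • gradient g p) r ↔
      ‖fderiv ℝ g p‖ * ‖q - p‖ ^ 2 + 2 * r * fderiv ℝ g p (q - p) ≤ 0 := by
    rw [← norm_sub_center_sq g (hΩ.fderiv_ne_zero p hpf), mem_closedBall_iff_norm,
      ← pow_le_pow_iff_left₀ (norm_nonneg _) hr.le two_ne_zero, ← sub_nonpos]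
    constructor
    · intro h
      exact mul_nonpos_of_nonneg_of_nonpos hN0.le h
    · intro h
      by_contra! hcon
      exact absurd h (not_le.2 (mul_pos hN0 hcon))
  have hzball := (hiff z).1 (hz _ ((hiff x).2 (hsupp p hpf x hx)) ((hiff y).2 (hsupp p hpf y hy)))
  have hzp0 : 0 < ‖z - p‖ := by
    rw [norm_pos_iff, sub_ne_zero]
    rintro h
    exact hzΩ (h ▸ hpΩ)
  have : 0 < ‖fderiv ℝ g p‖ * ‖z - p‖ ^ 2 := by positivity
  linarith [mul_nonneg (mul_nonneg zero_le_two hr.le) hout]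

/-- An `r`-convex set lies in the ball of radius `r` which is tangent at a boundary point. -/
theorem IsC11Domain.supporting_ball_of_isRConvex (hΩ : IsC11Domain Ω g) (hr : 0 < r)
    (hconv : IsRConvex r Ω) {p q : EuclideanSpace ℝ (Fin n)} (hp : p ∈ frontier Ω) (hq : q ∈ Ω) :
    ‖fderiv ℝ g p‖ * ‖q - p‖ ^ 2 + 2 * r * fderiv ℝ g p (q - p) ≤ 0 := by
  by_contra! hF
  set N := gradient g p with hNdef
  have hNw (w) : fderiv ℝ g p w = inner ℝ N w := inner_gradient_left.symm
  have hNn : ‖fderiv ℝ g p‖ = ‖N‖ := (norm_gradient_eq g p).symm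
  have hN0 : 0 < ‖N‖ := hNn ▸ norm_pos_iff.2 (hΩ.fderiv_ne_zero p hp)
  set d := q - p with hd
  have hd0 : 0 < ‖d‖ := by
    rw [norm_pos_iff]
    intro h
    simp [h] at hF
  rw [hNn] at hF
  -- The chord is tilted by `σ • N`: the lower bound makes it point outward, the upper bound leaves
  -- the slack `hgap`. By `hF` the two are compatible.
  obtain ⟨σ, hσ1, hσ2⟩ : ∃ σ, max 0 (-fderiv ℝ g p d / ‖N‖ ^ 2) < σ ∧
      σ < ‖d‖ ^ 2 / (2 * r * ‖N‖) := by
    refine exists_between (max_lt (by positivity) ?_)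
    rw [div_lt_div_iff₀ (by positivity) (by positivity)]
    nlinarith
  have hσ0 : 0 < σ := (le_max_left _ _).trans_lt hσ1
  have hout : 0 < fderiv ℝ g p (d + σ • N) := by
    have := (le_max_right _ _).trans_lt hσ1
    rw [div_lt_iff₀ (by positivity)] at this
    rw [map_add, map_smul, hNw N, real_inner_self_eq_norm_sq, smul_eq_mul]
    linarith
  have hgap : 0 < ‖d‖ ^ 2 - 2 * r * σ * ‖N‖ := by
    rw [lt_div_iff₀ (by positivity)] at hσ2
    linarith
  have hγ : HasDerivAt (fun t : ℝ => p + t • (d + σ • N)) (d + σ • N) 0 := by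
    simpa using ((hasDerivAt_id (0 : ℝ)).smul_const (d + σ • N)).const_add p
  have hev := hΩ.eventually_notMem (by simpa using hp) hγ (by simpa using hout)
  have hε : 0 < (‖d‖ ^ 2 - 2 * r * σ * ‖N‖) / (‖d + σ • N‖ ^ 2 + 1) := by positivity
  -- The bound on `t` does not depend on the centre `c`, so the point lies in all balls of the lens
  -- at once.
  obtain ⟨t, ht, ht1, ht2⟩ := (hev.and (inter_mem (Ioc_mem_nhdsGT (zero_lt_one' ℝ))
    (Ioc_mem_nhdsGT hε))).exists
  refine ht (hconv p (hΩ.mem_of_mem_frontier hp) q hq fun c hc1 hc2 => ?_)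
  have hsmall : t * ‖d + σ • N‖ ^ 2 ≤ ‖d‖ ^ 2 - 2 * r * σ * ‖N‖ := by
    have := (le_div_iff₀ (by positivity)).1 ht2.2
    linarith [ht1.1]
  rw [mem_closedBall_iff_norm, ← pow_le_pow_iff_left₀ (norm_nonneg _) hr.le two_ne_zero] at hc1 hc2 ⊢
  have e1 : q - c = (p - c) + d := by rw [hd]; abel
  have e2 : p + t • (d + σ • N) - c = (p - c) + t • (d + σ • N) := by abel
  rw [e1, norm_add_sq_real] at hc2
  rw [e2, norm_add_sq_real, inner_smul_right, inner_add_right, inner_smul_right, norm_smul,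
    mul_pow, Real.norm_eq_abs, sq_abs]
  have hcs : inner ℝ (p - c) N ≤ r * ‖N‖ :=
    (real_inner_le_norm _ _).trans (mul_le_mul_of_nonneg_right
      ((pow_le_pow_iff_left₀ (norm_nonneg _) hr.le two_ne_zero).1 hc1) (norm_nonneg _))
  have h1 := mul_le_mul_of_nonneg_left hcs hσ0.le
  have h2 : 0 ≤ (1 - t) * (r ^ 2 - ‖p - c‖ ^ 2) :=
    mul_nonneg (sub_nonneg.2 ht1.2) (sub_nonneg.2 hc1)
  have h3 : t * (2 * inner ℝ (p - c) d) ≤ t * (r ^ 2 - ‖p - c‖ ^ 2 - ‖d‖ ^ 2) :=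
    mul_le_mul_of_nonneg_left (by linarith) ht1.1.le
  have h4 := mul_le_mul_of_nonneg_left h1 (mul_nonneg zero_le_two ht1.1.le)
  have h5 := mul_le_mul_of_nonneg_left hsmall ht1.1.le
  nlinarith

end Lens

/-! ### From tangent balls to the second order condition -/

section Curvature

variable {E : Type*} [NormedAddCommGroup E] [InnerProductSpace ℝ E] {g : E → ℝ} {Ω : Set E}
  {r : ℝ}

/-- Near a boundary point `x`, the boundary has a point on the normal line over each tangent vector,
at quadratic distance. -/
theorem IsC11OnBall.exists_zero_over_tangent [CompleteSpace E] {x h : E} {δ K : ℝ}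
    (hg : IsC11OnBall g x δ K) (hgx : g x = 0) (hN : fderiv ℝ g x ≠ 0) (hh : fderiv ℝ g x h = 0) :
    ∃ C : ℝ, 0 ≤ C ∧ ∀ᶠ t in 𝓝[>] (0 : ℝ), ∃ s : ℝ, |s| ≤ C * t ^ 2 ∧
      g (x + (t • h + s • gradient g x)) = 0 := by
  set N := gradient g x with hNdef
  have hNw (w : E) : fderiv ℝ g x w = inner ℝ N w := inner_gradient_left.symm
  have hN0 : 0 < ‖N‖ := by rw [hNdef, norm_gradient_eq]; exact norm_pos_iff.2 hN
  have hK := hg.nonneg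
  -- At `s = ± C * t ^ 2` the linear term `s * ‖N‖ ^ 2` beats the Taylor remainder, whose part of
  -- order `t ^ 4` is absorbed by the `+ 1`. Hence `g` changes sign.
  set C := (K * ‖h‖ ^ 2 + 1) / ‖N‖ ^ 2 with hC
  have hC0 : 0 ≤ C := by positivity
  have hCN : C * ‖N‖ ^ 2 = K * ‖h‖ ^ 2 + 1 := div_mul_cancel₀ _ (by positivity)
  refine ⟨C, hC0, ?_⟩
  have e1 : ∀ᶠ t in 𝓝 (0 : ℝ), t * ‖h‖ + C * t ^ 2 * ‖N‖ < δ := by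
    have : ContinuousAt (fun t : ℝ => t * ‖h‖ + C * t ^ 2 * ‖N‖) 0 := by fun_prop
    exact this.eventually (gt_mem_nhds (by simpa using hg.pos))
  have e2 : ∀ᶠ t in 𝓝 (0 : ℝ), K * C ^ 2 * t ^ 2 * ‖N‖ ^ 2 < 1 := by
    have : ContinuousAt (fun t : ℝ => K * C ^ 2 * t ^ 2 * ‖N‖ ^ 2) 0 := by fun_prop
    exact this.eventually (gt_mem_nhds (by simp))
  filter_upwards [e1.filter_mono nhdsWithin_le_nhds, e2.filter_mono nhdsWithin_le_nhds,
    self_mem_nhdsWithin] with t h1 h2 ht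
  have ht : 0 < t := ht
  have hCt : 0 ≤ C * t ^ 2 := by positivity
  have hnorm {s : ℝ} (hs : |s| ≤ C * t ^ 2) : ‖t • h + s • N‖ < δ := by
    refine lt_of_le_of_lt ((norm_add_le _ _).trans ?_) h1
    rw [norm_smul, norm_smul, Real.norm_eq_abs, Real.norm_eq_abs, abs_of_pos ht]
    exact add_le_add_right (mul_le_mul_of_nonneg_right hs (norm_nonneg _)) _
  have hsq (s : ℝ) : ‖t • h + s • N‖ ^ 2 = t ^ 2 * ‖h‖ ^ 2 + s ^ 2 * ‖N‖ ^ 2 := by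
    rw [norm_add_sq_real, inner_smul_left, inner_smul_right, real_inner_comm, ← hNw, hh, norm_smul,
      norm_smul, mul_pow, mul_pow, Real.norm_eq_abs, Real.norm_eq_abs, sq_abs, sq_abs]
    simp
  have htay {s : ℝ} (hs : |s| ≤ C * t ^ 2) : |g (x + (t • h + s • N)) - s * ‖N‖ ^ 2| ≤
      K * (t ^ 2 * ‖h‖ ^ 2 + s ^ 2 * ‖N‖ ^ 2) := by
    have := hg.taylor (hnorm hs)
    rwa [hgx, sub_zero, map_add, map_smul, map_smul, hh, hNw, real_inner_self_eq_norm_sq, hsq,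
      smul_zero, zero_add, smul_eq_mul] at this
  have hcont : ContinuousOn (fun s : ℝ => g (x + (t • h + s • N)))
      (Icc (-(C * t ^ 2)) (C * t ^ 2)) := by
    intro s hs
    refine ContinuousAt.continuousWithinAt ?_
    refine ContinuousAt.comp (g := g) (hg.hasFDerivAt _ ?_).continuousAt (by fun_prop)
    rw [mem_ball_iff_norm, add_sub_cancel_left]
    exact hnorm (abs_le.2 hs)
  have hbound : K * (t ^ 2 * ‖h‖ ^ 2 + (C * t ^ 2) ^ 2 * ‖N‖ ^ 2) < C * t ^ 2 * ‖N‖ ^ 2 := by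
    have a1 : C * t ^ 2 * ‖N‖ ^ 2 = t ^ 2 * (K * ‖h‖ ^ 2 + 1) := by rw [← hCN]; ring
    have a2 : K * (t ^ 2 * ‖h‖ ^ 2 + (C * t ^ 2) ^ 2 * ‖N‖ ^ 2) =
      t ^ 2 * (K * ‖h‖ ^ 2 + K * C ^ 2 * t ^ 2 * ‖N‖ ^ 2) := by ring
    rw [a1, a2]
    exact mul_lt_mul_of_pos_left (by linarith) (by positivity)
  have hlow : g (x + (t • h + (-(C * t ^ 2)) • N)) ≤ 0 := by
    have := (abs_le.1 (htay (s := -(C * t ^ 2)) (by rw [abs_neg, abs_of_nonneg hCt]))).2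
    rw [neg_sq] at this
    linarith
  have hupp : 0 ≤ g (x + (t • h + (C * t ^ 2) • N)) := by
    have := (abs_le.1 (htay (s := C * t ^ 2) (by rw [abs_of_nonneg hCt]))).1
    linarith
  obtain ⟨s, hs, hs0⟩ := intermediate_value_Icc (by linarith) hcont ⟨hlow, hupp⟩
  exact ⟨s, abs_le.2 hs, hs0⟩

/-- If `Ω` lies in the tangent ball of radius `r` at each boundary point, then the boundary satisfies
the second order condition. -/
theorem IsC11Domain.hasCurvatureBound [CompleteSpace E] (hΩ : IsC11Domain Ω g) (hr : 0 < r)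
    (hsupp : ∀ p ∈ frontier Ω, ∀ q ∈ Ω,
      ‖fderiv ℝ g p‖ * ‖q - p‖ ^ 2 + 2 * r * fderiv ℝ g p (q - p) ≤ 0) :
    HasCurvatureBound r Ω g := by
  intro x hx h hh
  obtain ⟨δ, K, hg, hball⟩ := hΩ.exists_ball x hx
  obtain ⟨C, hC0, hex⟩ := hg.exists_zero_over_tangent (hΩ.eq_zero x hx) (hΩ.fderiv_ne_zero x hx) hh
  set N := gradient g x with hNdef
  have hNw (w : E) : fderiv ℝ g x w = inner ℝ N w := inner_gradient_left.symm
  have hNn : ‖fderiv ℝ g x‖ = ‖N‖ := (norm_gradient_eq g x).symm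
  have hN0 : 0 < ‖N‖ := hNn ▸ norm_pos_iff.2 (hΩ.fderiv_ne_zero x hx)
  have hK := hg.nonneg
  set M : ℝ → ℝ := fun t => t * ‖h‖ + C * t ^ 2 * ‖N‖ with hM
  -- `φ` is an explicit lower bound of the difference quotient, with the required limit.
  set φ : ℝ → ℝ := fun t => ‖h‖ ^ 2 / r * (‖N‖ - K * M t) - K * C * ‖N‖ * ‖h‖ * t with hφ
  have hφc : Tendsto (fun t => (φ t : EReal)) (𝓝[>] 0)
      (𝓝 ((1 / r * ‖fderiv ℝ g x‖ * ‖h‖ ^ 2 : ℝ) : EReal)) := by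
    refine (continuous_coe_real_ereal.tendsto _).comp ?_
    have : ContinuousAt φ 0 := by rw [hφ, hM]; fun_prop
    have h0 : φ 0 = 1 / r * ‖fderiv ℝ g x‖ * ‖h‖ ^ 2 := by
      rw [hφ, hM, hNn]; ring
    rw [← h0]
    exact this.tendsto.mono_left nhdsWithin_le_nhds
  rw [← hφc.liminf_eq]
  refine liminf_le_liminf ?_
  have hMc : ContinuousAt M 0 := by rw [hM]; fun_prop
  have hKMc : ContinuousAt (fun t => K * M t) 0 := by rw [hM]; fun_prop
  have e1 : ∀ᶠ t in 𝓝 (0 : ℝ), M t < δ :=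
    hMc.eventually (gt_mem_nhds (by simpa [hM] using hg.pos))
  have e2 : ∀ᶠ t in 𝓝 (0 : ℝ), K * M t < ‖N‖ :=
    hKMc.eventually (gt_mem_nhds (by simpa [hM] using hN0))
  filter_upwards [hex, e1.filter_mono nhdsWithin_le_nhds, e2.filter_mono nhdsWithin_le_nhds,
    self_mem_nhdsWithin] with t ⟨s, hs, hgs⟩ h1 h2 ht
  have ht : 0 < t := ht
  rw [EReal.coe_le_coe_iff]
  set y := x + (t • h + s • N) with hy
  have hyx : y - x = t • h + s • N := by rw [hy]; abel
  have hxy : x - y = -(t • h + s • N) := by rw [hy]; abel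
  have hyM : ‖y - x‖ ≤ M t := by
    rw [hyx]
    refine (norm_add_le _ _).trans ?_
    rw [norm_smul, norm_smul, Real.norm_eq_abs, Real.norm_eq_abs, abs_of_pos ht]
    exact add_le_add_right (mul_le_mul_of_nonneg_right hs (norm_nonneg _)) _
  have hyb : y ∈ Metric.ball x δ := mem_ball_iff_norm.2 (hyM.trans_lt h1)
  have hthb : x + t • h ∈ Metric.ball x δ := by
    rw [mem_ball_iff_norm, add_sub_cancel_left, norm_smul, Real.norm_eq_abs, abs_of_pos ht]
    refine lt_of_le_of_lt ?_ h1
    rw [hM]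
    have : 0 ≤ C * t ^ 2 * ‖N‖ := by positivity
    linarith
  have hyf : y ∈ frontier Ω := (hball y hyb).2 hgs
  have hsq : ‖y - x‖ ^ 2 = t ^ 2 * ‖h‖ ^ 2 + s ^ 2 * ‖N‖ ^ 2 := by
    rw [hyx, norm_add_sq_real, inner_smul_left, inner_smul_right, real_inner_comm, ← hNw, hh,
      norm_smul, norm_smul, mul_pow, mul_pow, Real.norm_eq_abs, Real.norm_eq_abs, sq_abs, sq_abs]
    simp
  have hsq' : t ^ 2 * ‖h‖ ^ 2 ≤ ‖y - x‖ ^ 2 := by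
    rw [hsq]; linarith [mul_nonneg (sq_nonneg s) (sq_nonneg ‖N‖)]
  -- `s1` bounds `-s` below by about `t ^ 2 * ‖h‖ ^ 2 / (2 * r * ‖N‖)`. In `s2` this and the
  -- quadratic term each give half of the bound for `g'(y) h`.
  have s1 := hsupp x hx y (hΩ.mem_of_mem_frontier hyf)
  have s2 := hsupp y hyf x (hΩ.mem_of_mem_frontier hx)
  rw [norm_sub_rev] at s2
  rw [hyx, map_add, map_smul, map_smul, hh, hNw, real_inner_self_eq_norm_sq, smul_zero, zero_add,
    smul_eq_mul, hNn, ← hyx] at s1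
  rw [hxy, map_neg, map_add, map_smul, map_smul, smul_eq_mul, smul_eq_mul] at s2
  have hdiff : ‖fderiv ℝ g y - fderiv ℝ g x‖ ≤ K * M t :=
    (hg.lipschitz y hyb x hg.mem_ball).trans (mul_le_mul_of_nonneg_left hyM hK)
  have hNy : ‖N‖ - K * M t ≤ ‖fderiv ℝ g y‖ := by
    have := norm_sub_norm_le (fderiv ℝ g x) (fderiv ℝ g y)
    rw [norm_sub_rev, hNn] at this
    linarith
  have hNyN : ‖N‖ * (‖N‖ - K * M t) ≤ fderiv ℝ g y N := by
    have a1 := (fderiv ℝ g y - fderiv ℝ g x).le_opNorm N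
    rw [sub_apply, hNw, real_inner_self_eq_norm_sq, Real.norm_eq_abs] at a1
    have a2 := (abs_le.1 a1).1
    have a3 := mul_le_mul_of_nonneg_right hdiff (norm_nonneg N)
    linarith
  set B := ‖N‖ - K * M t with hB
  have hB0 : 0 < B := sub_pos.2 h2
  -- the tangential derivative at `y`
  have hs1 : t ^ 2 * ‖h‖ ^ 2 ≤ 2 * r * (-s * ‖N‖) := by
    have : ‖N‖ * (‖y - x‖ ^ 2) ≤ ‖N‖ * (2 * r * (-s * ‖N‖)) := by linarith
    exact hsq'.trans (le_of_mul_le_mul_left this hN0)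
  have hsneg : 0 ≤ -s := by
    by_contra! hcon
    have : 2 * r * (-s * ‖N‖) < 0 := by
      have : 0 < 2 * r * ‖N‖ := by positivity
      nlinarith
    linarith [mul_nonneg (sq_nonneg t) (sq_nonneg ‖h‖)]
  have hth : ‖h‖ ^ 2 / r * B * t ≤ fderiv ℝ g y h := by
    have a1 : B * (t ^ 2 * ‖h‖ ^ 2) ≤ ‖fderiv ℝ g y‖ * ‖y - x‖ ^ 2 :=
      mul_le_mul hNy hsq' (by positivity) (norm_nonneg _)
    have a2 : -s * (‖N‖ * B) ≤ -s * fderiv ℝ g y N := mul_le_mul_of_nonneg_left hNyN hsneg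
    have a3 := mul_le_mul_of_nonneg_left hs1 hB0.le
    have a4 : (2 * r) * (-s * (‖N‖ * B)) ≤ (2 * r) * (-s * fderiv ℝ g y N) :=
      mul_le_mul_of_nonneg_left a2 (by positivity)
    have a5 : 2 * t * (‖h‖ ^ 2 * B * t) ≤ 2 * t * (r * fderiv ℝ g y h) := by linarith
    have a6 := le_of_mul_le_mul_left a5 (by positivity)
    have : ‖h‖ ^ 2 / r * B * t = ‖h‖ ^ 2 * B * t / r := by ring
    rw [this, div_le_iff₀ hr]
    linarith
  -- Replacing `y` by `x + t • h` costs only order `t ^ 2`, which vanishes after division by `t`.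
  have hlast : fderiv ℝ g y h - K * C * ‖N‖ * ‖h‖ * t ^ 2 ≤ fderiv ℝ g (x + t • h) h := by
    have a1 := (fderiv ℝ g (x + t • h) - fderiv ℝ g y).le_opNorm h
    rw [sub_apply, Real.norm_eq_abs] at a1
    have a2 := (abs_le.1 a1).1
    have a3 := hg.lipschitz _ hthb _ hyb
    have a4 : ‖x + t • h - y‖ ≤ C * t ^ 2 * ‖N‖ := by
      have : x + t • h - y = -(s • N) := by rw [hy]; abel
      rw [this, norm_neg, norm_smul, Real.norm_eq_abs]
      exact mul_le_mul_of_nonneg_right hs (norm_nonneg _)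
    have a5 := mul_le_mul_of_nonneg_right (a3.trans (mul_le_mul_of_nonneg_left a4 hK))
      (norm_nonneg h)
    linarith
  rw [le_div_iff₀ ht]
  calc φ t * t = ‖h‖ ^ 2 / r * B * t - K * C * ‖N‖ * ‖h‖ * t ^ 2 := by rw [hφ, hB]; ring
    _ ≤ _ := by linarith

end Curvature

/-! ### Sublevel sets as domains, and the conclusion -/

theorem isC11Domain_sublevelSet {n : ℕ} {U : Set (EuclideanSpace ℝ (Fin n))} (hU : IsOpen U)
    {g : EuclideanSpace ℝ (Fin n) → ℝ} (hgc : ContinuousOn g U)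
    (hgs : IsC11SubmersionOnZeroSet U g) (hclosed : IsClosed (sublevelSet U g)) :
    IsC11Domain (sublevelSet U g) g := by
  have hne {x} (hx : x ∈ U) (hgx : g x = 0) : fderiv ℝ g x ≠ 0 := by
    intro h
    obtain ⟨w, hw⟩ := (hgs x hx hgx).2 1
    simp [h] at hw
  have hloc {x} (hx : x ∈ U) (hgx : g x = 0) :
      ∃ δ K, IsC11OnBall g x δ K ∧ Metric.ball x δ ⊆ U := by
    obtain ⟨⟨V, hVo, hxV, hVU, hC1, K, hK⟩, -⟩ := hgs x hx hgx
    obtain ⟨δ, hδ, hsub⟩ := Metric.isOpen_iff.1 hVo x hxV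
    refine ⟨δ, K, ⟨hδ, K.2, fun z hz => ?_, fun z hz z' hz' => ?_⟩, hsub.trans hVU⟩
    · exact (((hC1.differentiableOn one_ne_zero) z (hsub hz)).differentiableAt
        (hVo.mem_nhds (hsub hz))).hasFDerivAt
    · exact hK.norm_sub_le (hsub hz) (hsub hz')
  -- A zero in the interior of the sublevel set would be a local maximum, hence a critical point.
  have hzero {x} (hx : x ∈ U) (hgx : g x = 0) : x ∈ frontier (sublevelSet U g) := by
    rw [hclosed.frontier_eq]
    refine ⟨⟨hx, hgx.le⟩, fun hi => hne hx hgx ?_⟩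
    refine IsLocalMax.fderiv_eq_zero ?_
    filter_upwards [mem_interior_iff_mem_nhds.1 hi] with y hy
    rw [hgx]
    exact hy.2
  have hfr {x} (hx : x ∈ frontier (sublevelSet U g)) : x ∈ U ∧ g x = 0 := by
    have hxΩ := hclosed.frontier_subset hx
    refine ⟨hxΩ.1, le_antisymm hxΩ.2 ?_⟩
    by_contra! hneg
    refine hx.2 (mem_interior_iff_mem_nhds.2 ?_)
    filter_upwards [hU.mem_nhds hxΩ.1,
      (hgc.continuousAt (hU.mem_nhds hxΩ.1)).eventually (gt_mem_nhds hneg)] with y hy hy'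
    exact ⟨hy, hy'.le⟩
  refine ⟨hclosed, fun p hp => (hfr hp).2, fun p hp => hne (hfr hp).1 (hfr hp).2, fun p hp => ?_⟩
  obtain ⟨δ, K, hg, hsub⟩ := hloc (hfr hp).1 (hfr hp).2
  exact ⟨δ, K, hg, fun z hz => ⟨⟨fun h => h.2, fun h => ⟨hsub hz, h⟩⟩, hzero (hsub hz)⟩⟩

theorem EuclideanSpace.exists_unit_orthogonal {n : ℕ} (hn : 2 ≤ n) (e : EuclideanSpace ℝ (Fin n)) :
    ∃ T : EuclideanSpace ℝ (Fin n), ‖T‖ = 1 ∧ inner ℝ e T = 0 := by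
  have hlt : Module.finrank ℝ (ℝ ∙ e) < Module.finrank ℝ (EuclideanSpace ℝ (Fin n)) := by
    rw [finrank_euclideanSpace_fin]
    exact ((finrank_span_le_card ({e} : Set _)).trans (by simp)).trans_lt hn
  have hne : (ℝ ∙ e)ᗮ ≠ ⊥ := by
    rw [Ne, Submodule.orthogonal_eq_bot_iff]
    intro h
    rw [h, finrank_top] at hlt
    exact lt_irrefl _ hlt
  obtain ⟨T, hT, hT0⟩ := Submodule.exists_mem_ne_zero_of_ne_bot hne
  refine ⟨‖T‖⁻¹ • T, norm_smul_inv_norm hT0, ?_⟩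
  rw [inner_smul_right, Submodule.mem_orthogonal_singleton_iff_inner_right.1 hT, mul_zero]

theorem mainTheorem3 (n : ℕ) (hn : n ≠ 1) (r : ℝ) (hr : 0 < r)
    (U : Set (EuclideanSpace ℝ (Fin n))) (hU : IsOpen U)
    (g : EuclideanSpace ℝ (Fin n) → ℝ) (hgc : ContinuousOn g U)
    (hgs : IsC11SubmersionOnZeroSet U g)
    (hclosed : IsClosed (sublevelSet U g)) (hconn : IsPreconnected (sublevelSet U g)) :
    IsRConvex r (sublevelSet U g) ↔
      ∀ x ∈ frontier (sublevelSet U g), ∀ h : EuclideanSpace ℝ (Fin n), fderiv ℝ g x h = 0 →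
        (((1 / r) * ‖fderiv ℝ g x‖ * ‖h‖ ^ 2 : ℝ) : EReal) ≤
          Filter.liminf (fun t : ℝ => ((fderiv ℝ g (x + t • h) h / t : ℝ) : EReal)) (𝓝[>] 0) := by
  have hΩ := isC11Domain_sublevelSet hU hgc hgs hclosed
  refine ⟨fun h => hΩ.hasCurvatureBound hr fun p hp q hq =>
    hΩ.supporting_ball_of_isRConvex hr h hp hq, fun h => hΩ.isRConvex hr fun p hp q hq => ?_⟩
  rcases Nat.lt_or_ge n 2 with h2 | h2
  -- In dimension zero every functional vanishes, so there is no boundary point.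
  · obtain rfl : n = 0 := by omega
    exact absurd (Subsingleton.elim _ _) (hΩ.fderiv_ne_zero p hp)
  · exact hΩ.supporting_ball hr h hconn (EuclideanSpace.exists_unit_orthogonal h2) hp hq
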